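/- Conventions. A circuit on a set of qubits is a product of unitary gates, each acting on at most two qubits; its complexity is the number of gates. For each $n\ge 1$ let $H_n$ be a normalized Hamiltonian on $n$ qubits, i.e. a Hermitian operator on $(\mathbb{C}^2)^{\otimes n}$ with operator norm $\|H_n\|=1$. Let $T,\alpha$ be real functions of $n$. The family $(H_n)$ is $(T,\alpha)$-fast-forwardable if there is a polynomial $q$ such that for every $n\ge1$ and every real $0\le t\le T(n)$ there are $c\le q(n)$ and a circuit $\widetilde U$ of complexity at most $q(n)$ on the $n$ qubits and $c$ ancilla qubits with $$\big\|(e^{-iH_nt}\otimes \mathbb 1_{2^c}-\widetilde U)\,|\psi\rangle\otimes|0\rangle\big\|\le\alpha(n)\quad\text{for all unit vectors }|\psi\rangle .$$ The family $(H_n)$ is $(\eta,\delta E,\beta)$-SEEM, for functions $\eta,\delta E,\beta$ of $n$, if there is a polynomial $q$ such that for every $n\ge1$ there are two unitaries $U,\widetilde U$ on the $n$ qubits, an output register (holding a binary fixed-point number $E'\in[-2,2)$) and a work register, with at most $q(n)$ output and work qubits in total, such that: (1) for every unit eigenvector $|\psi_E\rangle$ of $H_n$ with eigenvalue $E$, $$U|\psi_E,0,0\rangle=|\psi_E\rangle\sum_{E'}a_{E'}|E',g(E')\rangle$$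 for some amplitudes $a_{E'}$ and some unit vectors $g(E')$ of the work register with $\sum_{E':\,|E-E'|\le\delta E(n)}|a_{E'}|^2\ge\eta(n)$; (2) $\widetilde U$ is given by a circuit of complexity at most $q(n)$, and $\|U-\widetilde U\|\le\beta(n)$ in operator norm. Claim. Let $T(n)=O(2^{r(n)})$ for some polynomial $r$, with $T(n)\ge 1/32$ for all $n\ge1$. If $(H_n)$ is $(T,\alpha)$-fast-forwardable, then it is also $$\Big(1-e^{-n/18},\ \frac1T,\ 16\,n\,\alpha\,\log_2(32T)\Big)\text{-SEEM}.$$ -/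

import Mathlib

open scoped Matrix.Norms.L2Operator

noncomputable section

/-- A computational basis state of qubits indexed by `ι`: one bit for each qubit. -/
abbrev Bits (ι : Type) : Type := ι → Bool

/-- The Hilbert space of the qubits indexed by `ι`. -/
abbrev QState (ι : Type) [Fintype ι] : Type := EuclideanSpace ℂ (Bits ι)

/-- Operators on the qubits indexed by `ι`, as matrices in the computational basis.
The norm on them is the operator norm for the Hilbert space norm. -/
abbrev QOp (ι : Type) : Type := Matrix (Bits ι) (Bits ι) ℂ

/-- The action of an operator on a state. -/
def QOp.app {ι : Type} [Fintype ι] [DecidableEq ι] (M : QOp ι) (ψ : QState ι) : QState ι :=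
  Matrix.toEuclideanLin M ψ

/-- The tensor product of states of two registers. -/
def tensorState {ι κ : Type} [Fintype ι] [Fintype κ] (ψ : QState ι) (φ : QState κ) :
    QState (ι ⊕ κ) :=
  WithLp.toLp 2 fun x => ψ (fun i => x (Sum.inl i)) * φ (fun k => x (Sum.inr k))

/-- The computational basis state `|b⟩`. -/
def basisKet {ι : Type} [Fintype ι] [DecidableEq ι] (b : Bits ι) : QState ι :=
  EuclideanSpace.single b 1

/-- The state `|0…0⟩`. -/
def zeroKet (ι : Type) [Fintype ι] [DecidableEq ι] : QState ι :=
  basisKet fun _ => false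

/-- The operator `M ⊗ 1` on two registers, acting as `M` on the first one. -/
def tensorId {ι : Type} (κ : Type) [DecidableEq (Bits κ)] (M : QOp ι) : QOp (ι ⊕ κ) :=
  fun x y =>
    if (fun k => x (Sum.inr k)) = (fun k => y (Sum.inr k)) then
      M (fun i => x (Sum.inl i)) (fun i => y (Sum.inl i))
    else 0

/-- The operator `G`, given on the qubits of `S`, extended by the identity to all the qubits. -/
def extendGate {ι : Type} [Fintype ι] [DecidableEq ι] (S : Finset ι) (G : QOp S) : QOp ι :=
  fun x y =>
    if ∀ i, i ∉ S → x i = y i then G (fun i => x i) (fun i => y i) else 0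

/-- An elementary gate: an arbitrary unitary on at most two of the qubits. -/
def IsGate {ι : Type} [Fintype ι] [DecidableEq ι] (M : QOp ι) : Prop :=
  ∃ S : Finset ι, S.card ≤ 2 ∧ ∃ G ∈ Matrix.unitaryGroup (Bits S) ℂ, M = extendGate S G

/-- `M` is implemented exactly by a quantum circuit of at most `s` elementary gates. -/
def HasCircuit {ι : Type} [Fintype ι] [DecidableEq ι] (M : QOp ι) (s : ℕ) : Prop :=
  ∃ L : List (QOp ι), L.length ≤ s ∧ (∀ g ∈ L, IsGate g) ∧ M = L.prod

/-- A normalized Hamiltonian on `n` qubits: a Hermitian operator of operator norm `1`. -/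
structure NormalizedHamiltonian (n : ℕ) where
  /-- The underlying operator. -/
  op : QOp (Fin n)
  isHermitian : op.IsHermitian
  norm_eq_one : ‖op‖ = 1

/-- The time evolution `e^{-iHt}`. -/
def NormalizedHamiltonian.evolution {n : ℕ} (H : NormalizedHamiltonian n) (t : ℝ) :
    QOp (Fin n) :=
  NormedSpace.exp ((-(Complex.I * (t : ℂ))) • H.op)

/-- The family `H` of normalized Hamiltonians is `(T, α)`-fast-forwardable: up to time `T n`
the evolution is simulated to within `α n`, on ancillas initialized to `0`, by circuits with a
polynomial number of gates and of ancillas. -/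
def IsFF (H : ∀ n : ℕ, NormalizedHamiltonian n) (T α : ℕ → ℝ) : Prop :=
  ∃ q : Polynomial ℕ, ∀ n : ℕ, 1 ≤ n → ∀ t : ℝ, 0 ≤ t → t ≤ T n →
    ∃ c : ℕ, c ≤ q.eval n ∧ ∃ V : QOp (Fin n ⊕ Fin c), HasCircuit V (q.eval n) ∧
      ∀ ψ : QState (Fin n), ‖ψ‖ = 1 →
        ‖(tensorId (Fin c) ((H n).evolution t) - V).app
          (tensorState ψ (zeroKet (Fin c)))‖ ≤ α n

/-- The number written on an output register of `p + 2` qubits (qubit `k` has weight `2 ^ k`).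
It is a fixed-point binary number in `[-2, 2)` with `p` bits after the point, in offset binary
notation: the integer `m` stands for `m / 2 ^ p - 2`. -/
def outcomeValue {p : ℕ} (e : Bits (Fin (p + 2))) : ℝ :=
  (∑ k : Fin (p + 2), if e k then (2 : ℝ) ^ (k : ℕ) else 0) / 2 ^ p - 2

/-- `U` is a non-demolition energy pre-measurement of `η`-accuracy `δE` for `H`, with an output
register of `p + 2` qubits and a work register of `w` qubits: for each eigenstate `ψ` of `H`
with energy `E`,
`U |ψ, 0, 0⟩ = |ψ⟩ ∑ a_{E'} |E', g(E')⟩` and the outcome `E'` satisfies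
`Pr (|E - E'| ≤ δE) ≥ η`. -/
def IsPremeasurement {n p w : ℕ} (H : NormalizedHamiltonian n) (η δE : ℝ)
    (U : QOp (Fin n ⊕ (Fin (p + 2) ⊕ Fin w))) : Prop :=
  ∀ (E : ℝ) (ψ : QState (Fin n)), ‖ψ‖ = 1 → H.op.app ψ = (E : ℂ) • ψ →
    ∃ (a : Bits (Fin (p + 2)) → ℂ) (g : Bits (Fin (p + 2)) → QState (Fin w)),
      (∀ e, ‖g e‖ = 1) ∧
      U.app (tensorState ψ (tensorState (zeroKet (Fin (p + 2))) (zeroKet (Fin w)))) =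
        tensorState ψ (∑ e, a e • tensorState (basisKet e) (g e)) ∧
      η ≤ ∑ e with |E - outcomeValue e| ≤ δE, ‖a e‖ ^ 2

/-- The family `H` of normalized Hamiltonians is `(η, δE, β)`-SEEM (super-efficient energy
measurable): an exact pre-measurement `U` is approximated in operator norm to within `β n` by a
unitary `V` that has a circuit with a polynomial number of gates and of additional qubits. -/
def IsSEEM (H : ∀ n : ℕ, NormalizedHamiltonian n) (η δE β : ℕ → ℝ) : Prop :=
  ∃ q : Polynomial ℕ, ∀ n : ℕ, 1 ≤ n →
    ∃ p w : ℕ, p + 2 + w ≤ q.eval n ∧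
      ∃ U V : QOp (Fin n ⊕ (Fin (p + 2) ⊕ Fin w)),
        U ∈ Matrix.unitaryGroup _ ℂ ∧ V ∈ Matrix.unitaryGroup _ ℂ ∧
        IsPremeasurement (H n) (η n) (δE n) U ∧
        HasCircuit V (q.eval n) ∧ ‖U - V‖ ≤ β n

end

/-!
The pre-measurement is phase estimation, one binary digit at a time. On an eigenstate of energy `E`
the evolution `e^{-iHt}` is a multiplication by a phase, so that the evolution controlled by another
qubit acts on that qubit alone and leaves the eigenstate as it is. Let `x = (E + 2) 2 ^ p`, where
`2 ^ p ≤ 4 T / 3 < 2 ^ (p + 1)`, so that an integer within `2 / 3` of `x` determines the energy to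
within `1 / T`. Given the digits `b i`, `i < k`, the digit `k` is `0` or `1` according as the phase
`π (x - ∑ i < k, b i 2 ^ i) / 2 ^ k` is nearly `0` or `π`, modulo `2 π`. A Hadamard test on the
evolution for the time `π 2 ^ p / 2 ^ k`, corrected by phases controlled by the earlier digits,
gives the answer `1` with probability `sin ^ 2` of half that phase. The test is repeated `3 n` times
and a circuit that counts the answers writes their majority on the output qubit `k`
(`levelOp_app_estState`, `exists_majority_circuit`).

*Accuracy.* If `x` is within `1 / 3` of an integer `N`, the majority at level `k` differs from the
digit of `N` with probability at most `|sin (π (x - N) / 2 ^ k)| ^ (3 n)`, and these numbers add up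
to at most `e^{-n/18}`. Otherwise the two integers next to `x` are both within `2 / 3`. Their lowest
digits differ, so either answer at level `0` is right for one of them, and the higher levels err
with the same total probability, as the angles `π (x - N) / 2 ^ k` with `1 ≤ k` are again at most
`π / 3` (`one_sub_exp_le_sum_outcomeProb`).

*Exactness.* A pre-measurement has to leave the eigenstate exactly unentangled from the other
registers, while a circuit that simulates the evolution only approximately need not return its
ancillas to `0`. But if a unitary `V` agrees with `X ⊗ 1` up to `α ≤ 1 / 8` on the states with
ancillas `0`, then a unitary at distance at most `9 / 4 α` from `V`, in operator norm, agrees with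
`X ⊗ 1` exactly on these states (`exists_exact_near_approximate`). It is `V` followed by the Cayley
transform of a small skew-adjoint operator, which moves one isometry to the other
(`exists_unitary_extension`). So the exact operation may use the same ancillas again and again, and
the errors of the circuit add up (`Simulable`).

*Cost.* A controlled two-qubit gate is a product of seven gates (`HasCircuit.ctrl`). A test at level
`k` uses `⌈π 2 ^ p / (2 ^ k T)⌉` simulated evolutions, at most `p + 10.38` in all levels together
(`sum_queries_le`), and since `p + 4 ≤ log₂ (32 T)` the total error `3 n (p + 10.38) (9 / 4) α` is
at most `16 n α log₂ (32 T)`. If `α > 1 / 8`, this bound exceeds `2`, the largest distance of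
two unitaries. If `T ≤ 1`, the constant outcome `0` is accurate enough.
-/

set_option linter.unusedSectionVars false

/-! ### Diagonalization of unitary matrices -/

/-- The spectral theorem for unitary matrices: a unitary `G` is `exp (i X)` for the Hermitian matrix
`X = arg G` of the continuous functional calculus, which is diagonalized by a unitary. -/
theorem Matrix.exists_diagonalization_of_unitary {ι : Type*} [Fintype ι] [DecidableEq ι]
    {G : Matrix ι ι ℂ} (hG : G ∈ Matrix.unitaryGroup ι ℂ) :
    ∃ W ∈ Matrix.unitaryGroup ι ℂ, ∃ d : ι → ℂ, (∀ i, ‖d i‖ = 1) ∧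
      G = W * Matrix.diagonal d * star W := by
  have hN : IsStarNormal G :=
    ⟨(Unitary.star_mul_self_of_mem hG).trans (Unitary.mul_star_self_of_mem hG).symm⟩
  have hfin : (spectrum ℂ G).Finite := Matrix.finite_spectrum G
  have hnorm : ∀ z ∈ spectrum ℂ G, ‖z‖ = 1 := fun z hz => by
    simpa using spectrum.subset_circle_of_unitary hG hz
  set X : Matrix ι ι ℂ := cfc (fun z => (Complex.arg z : ℂ)) G with hX
  have hXh : X.IsHermitian := by
    change star X = X
    rw [hX, ← cfc_star]
    simp
  have hexp : NormedSpace.exp (Complex.I • X) = G := by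
    have hc := hfin.continuousOn (fun z => Complex.I • (Complex.arg z : ℂ))
    rw [hX, ← cfc_smul _ _ _ (hfin.continuousOn _), ← CFC.exp_eq_normedSpace_exp (𝕜 := ℂ),
      ← cfc_comp _ _ _ hN ((hfin.image _).continuousOn _) hc]
    conv_rhs => rw [← cfc_id ℂ G]
    refine cfc_congr fun z hz => ?_
    have := Complex.norm_mul_exp_arg_mul_I z
    rw [hnorm z hz] at this
    simpa [← Complex.exp_eq_exp_ℂ, mul_comm] using this
  refine ⟨hXh.eigenvectorUnitary, Subtype.mem _,
    fun i => Complex.exp (Complex.I * hXh.eigenvalues i), fun i => ?_, ?_⟩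
  · simp only [mul_comm Complex.I, Complex.norm_exp_ofReal_mul_I]
  · have h := hXh.spectral_theorem
    rw [Unitary.conjStarAlgAut_apply] at h
    have hu : (hXh.eigenvectorUnitary : Matrix ι ι ℂ)⁻¹ =
        star (hXh.eigenvectorUnitary : Matrix ι ι ℂ) :=
      Matrix.inv_eq_right_inv (Unitary.mul_star_self_of_mem (Subtype.mem _))
    have hunit : IsUnit (hXh.eigenvectorUnitary : Matrix ι ι ℂ) :=
      ⟨Unitary.toUnits hXh.eigenvectorUnitary, rfl⟩
    rw [← hexp]
    conv_lhs => rw [h]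
    rw [← smul_mul_assoc, ← mul_smul_comm, ← hu, Matrix.exp_conj _ _ hunit, ← Matrix.diagonal_smul,
      Matrix.exp_diagonal]
    congr 3
    ext i
    simp [Pi.coe_exp, ← Complex.exp_eq_exp_ℂ]

/-! ### Operators on chosen wires, and circuits -/

noncomputable section

variable {ι κ μ : Type} [Fintype ι] [DecidableEq ι] [Fintype κ] [DecidableEq κ] [Fintype μ]
  [DecidableEq μ]

/-- `x` with the bits in the range of `f` replaced by the bits of `v`. -/
def overwrite (f : ι ↪ κ) (x : Bits κ) (v : Bits ι) : Bits κ := Function.extend f v x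

@[simp] lemma overwrite_apply (f : ι ↪ κ) (x : Bits κ) (v : Bits ι) (i : ι) :
    overwrite f x v (f i) = v i := f.injective.extend_apply _ _ _

lemma overwrite_of_notMem (f : ι ↪ κ) (x : Bits κ) (v : Bits ι) {k : κ} (hk : k ∉ Set.range f) :
    overwrite f x v k = x k := Function.extend_apply' _ _ _ (by simpa using hk)

@[simp] lemma overwrite_comp (f : ι ↪ κ) (x : Bits κ) (v : Bits ι) :
    overwrite f x v ∘ f = v := funext fun i => overwrite_apply f x v i

lemma overwrite_eq_iff (f : ι ↪ κ) (x y : Bits κ) (v : Bits ι) :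
    overwrite f x v = y ↔ y ∘ f = v ∧ ∀ k ∉ Set.range f, x k = y k := by
  constructor
  · rintro rfl
    exact ⟨overwrite_comp f x v, fun k hk => (overwrite_of_notMem f x v hk).symm⟩
  · rintro ⟨rfl, h⟩
    ext k
    by_cases hk : k ∈ Set.range f
    · obtain ⟨i, rfl⟩ := hk
      simp
    · rw [overwrite_of_notMem f x _ hk, h k hk]

/-- The operator on the qubits `κ` that acts as `M` on the wires `f i` and as the identity on the
others. -/
def place (f : ι ↪ κ) (M : QOp ι) : QOp κ :=
  fun x y => if y = overwrite f x (y ∘ f) then M (x ∘ f) (y ∘ f) else 0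

/-- The bit strings that agree with `x` off the range of `f` are parametrized by their bits
there. -/
lemma sum_overwrite {β : Type*} [AddCommMonoid β] (f : ι ↪ κ) (x : Bits κ) (F : Bits κ → β) :
    ∑ y, (if y = overwrite f x (y ∘ f) then F y else 0) = ∑ v, F (overwrite f x v) := by
  rw [← Finset.sum_filter]
  refine Finset.sum_nbij' (fun y => y ∘ f) (fun v => overwrite f x v) ?_ ?_ ?_ ?_ ?_
  · simp
  · intro v _
    simp
  · intro y hy
    exact (Finset.mem_filter.mp hy).2.symm
  · intro v _
    simp
  · intro y hy
    exact congrArg F (Finset.mem_filter.mp hy).2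

lemma app_apply (M : QOp ι) (φ : QState ι) (x : Bits ι) : M.app φ x = ∑ y, M x y * φ y := by
  simp [QOp.app, Matrix.toEuclideanLin, Matrix.mulVec, dotProduct]

lemma place_app (f : ι ↪ κ) (M : QOp ι) (φ : QState κ) (x : Bits κ) :
    (place f M).app φ x = ∑ v, M (x ∘ f) v * φ (overwrite f x v) := by
  simp only [app_apply, place, ite_mul, zero_mul]
  rw [sum_overwrite f x fun y => M (x ∘ f) (y ∘ f) * φ y]
  simp

lemma overwrite_overwrite (f : ι ↪ κ) (x : Bits κ) (v w : Bits ι) :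
    overwrite f (overwrite f x v) w = overwrite f x w := by
  rw [overwrite_eq_iff]
  refine ⟨overwrite_comp .., fun k hk => ?_⟩
  rw [overwrite_of_notMem f _ _ hk, overwrite_of_notMem f _ _ hk]

lemma ext_app {M N : QOp ι} (h : ∀ φ, M.app φ = N.app φ) : M = N :=
  Matrix.toEuclideanLin.injective (LinearMap.ext h)

lemma mul_app (M N : QOp ι) (φ : QState ι) : QOp.app (M * N) φ = M.app (N.app φ) := by
  simp [QOp.app, Matrix.toEuclideanLin]

@[simp] lemma one_app (φ : QState ι) : (1 : QOp ι).app φ = φ := by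
  simp [QOp.app, Matrix.toEuclideanLin]

lemma add_app (M N : QOp ι) (φ : QState ι) : QOp.app (M + N) φ = M.app φ + N.app φ := by
  simp [QOp.app]

lemma sub_app (M N : QOp ι) (φ : QState ι) : QOp.app (M - N) φ = M.app φ - N.app φ := by
  simp [QOp.app]

lemma place_mul (f : ι ↪ κ) (M N : QOp ι) : place f (M * N) = place f M * place f N := by
  refine ext_app fun φ => ?_
  ext x
  simp only [mul_app, place_app, overwrite_comp, overwrite_overwrite, Matrix.mul_apply,
    Finset.sum_mul, Finset.mul_sum, mul_assoc]
  exact Finset.sum_comm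

@[simp] lemma overwrite_self (f : ι ↪ κ) (x : Bits κ) : overwrite f x (x ∘ f) = x := by
  rw [overwrite_eq_iff]; simp

@[simp] lemma place_one (f : ι ↪ κ) : place f (1 : QOp ι) = 1 := by
  refine ext_app fun φ => ?_
  ext x
  simp [place_app, Matrix.one_apply]

lemma overwrite_comm_iff (f : ι ↪ κ) (x y : Bits κ) :
    y = overwrite f x (y ∘ f) ↔ x = overwrite f y (x ∘ f) := by
  rw [eq_comm, overwrite_eq_iff, @eq_comm _ x, overwrite_eq_iff]
  simp [eq_comm]

lemma place_star (f : ι ↪ κ) (M : QOp ι) : place f (star M) = star (place f M) := by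
  ext x y
  simp only [place, Matrix.star_apply, overwrite_comm_iff f x y]
  split_ifs <;> simp

/-- `place f` as a homomorphism of star algebras, which is therefore norm-decreasing. -/
def placeHom (f : ι ↪ κ) : QOp ι →⋆ₙₐ[ℂ] QOp κ where
  toFun := place f
  map_smul' c M := by ext x y; simp [place]
  map_zero' := by ext x y; simp [place]
  map_add' M N := by ext x y; simp only [place, Matrix.add_apply]; split_ifs <;> simp
  map_mul' := place_mul f
  map_star' := place_star f

lemma norm_place_sub_le (f : ι ↪ κ) (M N : QOp ι) : ‖place f M - place f N‖ ≤ ‖M - N‖ := by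
  have h := NonUnitalStarAlgHom.norm_apply_le (placeHom f) (M - N)
  rwa [map_sub] at h

lemma place_mem_unitary (f : ι ↪ κ) {M : QOp ι} (hM : M ∈ Matrix.unitaryGroup (Bits ι) ℂ) :
    place f M ∈ Matrix.unitaryGroup (Bits κ) ℂ := by
  rw [Matrix.mem_unitaryGroup_iff] at hM ⊢
  rw [← place_star, ← place_mul, hM, place_one]

lemma place_place (f : ι ↪ κ) (g : κ ↪ μ) (M : QOp ι) :
    place g (place f M) = place (f.trans g) M := by
  refine ext_app fun φ => ?_
  ext x
  rw [place_app, place_app]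
  simp only [place, ite_mul, zero_mul]
  rw [sum_overwrite f (x ∘ g) fun y => M ((x ∘ g) ∘ f) (y ∘ f) * φ (overwrite g x y)]
  refine Finset.sum_congr rfl fun v _ => ?_
  rw [overwrite_comp]
  congr 1
  refine congrArg φ (Eq.symm ?_)
  rw [overwrite_eq_iff]
  refine ⟨?_, fun k hk => ?_⟩
  · ext i; simp
  · by_cases hk' : k ∈ Set.range g
    · obtain ⟨j, rfl⟩ := hk'
      rw [overwrite_apply, overwrite_of_notMem]
      · rfl
      · rintro ⟨i, rfl⟩; exact hk ⟨i, rfl⟩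
    · rw [overwrite_of_notMem _ _ _ hk']

lemma extendGate_eq_place (S : Finset ι) (G : QOp S) :
    extendGate S G = place (Function.Embedding.subtype _) G := by
  ext x y
  simp only [extendGate, place]
  congr 1
  rw [eq_comm (a := y), overwrite_eq_iff]
  simp

lemma isGate_place (f : ι ↪ κ) (hc : Fintype.card ι ≤ 2) {G : QOp ι}
    (hG : G ∈ Matrix.unitaryGroup (Bits ι) ℂ) : IsGate (place f G) := by
  refine ⟨Finset.univ.map f, by simpa using hc, ?_⟩
  let e : ι ↪ (Finset.univ.map f : Finset κ) :=
    ⟨fun i => ⟨f i, by simp⟩, fun i j h => by simpa using h⟩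
  refine ⟨place e G, place_mem_unitary e hG, ?_⟩
  rw [extendGate_eq_place, place_place]
  rfl

lemma IsGate.place {G : QOp ι} (hG : IsGate G) (f : ι ↪ κ) : IsGate (place f G) := by
  obtain ⟨S, hS, G, hG, rfl⟩ := hG
  rw [extendGate_eq_place, place_place]
  exact isGate_place _ (by simpa using hS) hG

lemma IsGate.mem_unitary {G : QOp ι} (hG : IsGate G) : G ∈ Matrix.unitaryGroup (Bits ι) ℂ := by
  obtain ⟨S, hS, G, hG, rfl⟩ := hG
  rw [extendGate_eq_place]
  exact place_mem_unitary _ hG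

lemma HasCircuit.mem_unitary {M : QOp ι} {s : ℕ} (h : HasCircuit M s) :
    M ∈ Matrix.unitaryGroup (Bits ι) ℂ := by
  obtain ⟨L, -, hL, rfl⟩ := h
  exact Submonoid.list_prod_mem _ fun g hg => (hL g hg).mem_unitary

lemma IsGate.hasCircuit {G : QOp ι} (hG : IsGate G) : HasCircuit G 1 :=
  ⟨[G], by simp, by simpa using hG, by simp⟩

lemma HasCircuit.one : HasCircuit (1 : QOp ι) 0 := ⟨[], by simp, by simp, by simp⟩

lemma HasCircuit.mul {M N : QOp ι} {s t : ℕ} (hM : HasCircuit M s) (hN : HasCircuit N t) :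
    HasCircuit (M * N) (s + t) := by
  obtain ⟨L, hs, hL, rfl⟩ := hM
  obtain ⟨K, ht, hK, rfl⟩ := hN
  refine ⟨L ++ K, by simp; omega, ?_, by simp⟩
  simp only [List.mem_append]
  rintro g (h | h)
  exacts [hL g h, hK g h]

lemma HasCircuit.mono {M : QOp ι} {s t : ℕ} (hM : HasCircuit M s) (h : s ≤ t) : HasCircuit M t := by
  obtain ⟨L, hs, hL⟩ := hM
  exact ⟨L, hs.trans h, hL⟩

lemma HasCircuit.list_prod {s : ℕ} (L : List (QOp ι)) (hL : ∀ M ∈ L, HasCircuit M s) :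
    HasCircuit L.prod (L.length * s) := by
  induction L with
  | nil => simpa using HasCircuit.one
  | cons M L ih =>
    simp only [List.mem_cons, forall_eq_or_imp] at hL
    simpa [add_mul, add_comm] using hL.1.mul (ih hL.2)

/-- A map of operators that is multiplicative turns circuits into circuits if it does so for
single gates. -/
lemma HasCircuit.map {M : QOp ι} {s t : ℕ} (hM : HasCircuit M s) (F : QOp ι → QOp κ) (h1 : F 1 = 1)
    (hmul : ∀ A B, F (A * B) = F A * F B) (hF : ∀ G, IsGate G → HasCircuit (F G) t) :
    HasCircuit (F M) (s * t) := by
  obtain ⟨L, hs, hL, rfl⟩ := hM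
  have : F L.prod = (L.map F).prod := by
    clear hs hL
    induction L with
    | nil => simpa using h1
    | cons M L ih => simp [hmul, ih]
  rw [this]
  refine (HasCircuit.list_prod (s := t) (L.map F) ?_).mono
    (by simpa using Nat.mul_le_mul_right t hs)
  simp only [List.mem_map]
  rintro _ ⟨g, hg, rfl⟩
  exact hF g (hL g hg)

lemma HasCircuit.place {M : QOp ι} {s : ℕ} (hM : HasCircuit M s) (f : ι ↪ κ) :
    HasCircuit (place f M) s := by
  simpa using hM.map (_root_.place f) (place_one f) (place_mul f) fun G hG =>
    (hG.place f).hasCircuit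

end

/-! ### Isometries close to each other -/

open Matrix ComplexOrder in
/-- If the isometries `J` and `F` are close, then `F = U J` for a unitary `U` close to `1`. With
`N = J + F` and `D = F - J`, the equation `U J = F` holds for the Cayley transform
`U = (1 - A)⁻¹ (1 + A)` as soon as `A N = D`. A skew-adjoint solution is `A = D B - (D B)ᴴ (1 - P)`,
where `B` is the Moore–Penrose inverse of `N` and `P = N B` is the projection onto the range of `N`;
it is skew-adjoint because `Nᴴ D` is. -/
theorem exists_unitary_extension {m k : Type*} [Fintype m] [DecidableEq m] [Nonempty m] [Fintype k]
    [DecidableEq k] {J F : Matrix m k ℂ} (hJ : Jᴴ * J = 1) (hF : Fᴴ * F = 1) {ε : ℝ}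
    (hε : ε ≤ 1 / 8) (h : ‖F - J‖ ≤ ε) :
    ∃ U ∈ Matrix.unitaryGroup m ℂ, U * J = F ∧ ‖U - 1‖ ≤ 9 / 4 * ε := by
  have hε0 : 0 ≤ ε := (norm_nonneg _).trans h
  set N := J + F with hN
  set D := F - J with hD
  have hND : Nᴴ * D = -(Dᴴ * N) := by
    simp only [hN, hD, conjTranspose_add, conjTranspose_sub, Matrix.add_mul, Matrix.sub_mul,
      Matrix.mul_add, Matrix.mul_sub, hJ, hF]
    abel
  have isom : ∀ x : EuclideanSpace ℂ k, ‖WithLp.toLp 2 (J *ᵥ x.ofLp)‖ = ‖x‖ := fun x => by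
    have h1 : (inner ℂ (WithLp.toLp 2 (J *ᵥ x.ofLp)) (WithLp.toLp 2 (J *ᵥ x.ofLp)) : ℂ) =
        inner ℂ x x := by
      rw [EuclideanSpace.inner_eq_star_dotProduct, EuclideanSpace.inner_eq_star_dotProduct]
      simp only [star_mulVec, dotProduct_comm (J *ᵥ _), ← dotProduct_mulVec, mulVec_mulVec,
        hJ, one_mulVec]
      rw [dotProduct_comm]
    rw [inner_self_eq_norm_sq_to_K, inner_self_eq_norm_sq_to_K] at h1
    norm_cast at h1
    simpa using (pow_left_inj₀ (norm_nonneg _) (norm_nonneg _) two_ne_zero).mp h1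
  have hNx : ∀ x : EuclideanSpace ℂ k, (2 - ε) * ‖x‖ ≤ ‖WithLp.toLp 2 (N *ᵥ x.ofLp)‖ := fun x => by
    have h1 : WithLp.toLp 2 (N *ᵥ x.ofLp) = (2 : ℂ) • WithLp.toLp 2 (J *ᵥ x.ofLp) +
        WithLp.toLp 2 (D *ᵥ x.ofLp) := by
      ext i
      simp [hN, hD, add_mulVec, sub_mulVec]
      ring
    have h2 : ‖WithLp.toLp 2 (D *ᵥ x.ofLp)‖ ≤ ε * ‖x‖ :=
      (l2_opNorm_mulVec D x).trans (by gcongr)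
    have h3 := norm_sub_le_norm_add ((2 : ℂ) • WithLp.toLp 2 (J *ᵥ x.ofLp))
      (WithLp.toLp 2 (D *ᵥ x.ofLp))
    rw [← h1, norm_smul, isom] at h3
    norm_num at h3
    linarith
  clear_value D
  -- so `N` is injective, and its Gram matrix is invertible
  have hinj : Function.Injective N.mulVec := by
    refine (injective_iff_map_eq_zero (Matrix.mulVecLin N)).mpr fun x hx => ?_
    have := hNx (WithLp.toLp 2 x)
    simp only [mulVecLin_apply] at hx
    simp only [hx, WithLp.toLp_zero, norm_zero] at this
    have h0 : ‖WithLp.toLp 2 x‖ = 0 := by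
      nlinarith [norm_nonneg (WithLp.toLp 2 x)]
    simpa using h0
  have hG : (Nᴴ * N).PosDef := Matrix.PosDef.conjTranspose_mul_self N hinj
  have hGu : IsUnit (Nᴴ * N).det := (Matrix.isUnit_iff_isUnit_det _).mp hG.isUnit
  set B := (Nᴴ * N)⁻¹ * Nᴴ with hB
  have hBN : B * N = 1 := by rw [hB, Matrix.mul_assoc, nonsing_inv_mul _ hGu]
  set P := N * B with hP
  have hPs : Pᴴ = P := by
    simp only [hP, hB, conjTranspose_mul, conjTranspose_nonsing_inv, conjTranspose_conjTranspose,
      Matrix.mul_assoc]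
  have hPP : P * P = P := by
    rw [hP, Matrix.mul_assoc, ← Matrix.mul_assoc B, hBN, Matrix.one_mul]
  have hproj : IsStarProjection P := ⟨hPP, hPs⟩
  have hPn : ‖P‖ ≤ 1 := hproj.norm_le
  have hPn' : ‖1 - P‖ ≤ 1 := hproj.one_sub.norm_le
  have hBn : ‖B‖ ≤ (2 - ε)⁻¹ := by
    rw [l2_opNorm_def]
    refine ContinuousLinearMap.opNorm_le_bound _ (by rw [inv_nonneg]; linarith) fun v => ?_
    have h1 := hNx (WithLp.toLp 2 (B *ᵥ v.ofLp))
    have h2 := (l2_opNorm_mulVec P v).trans (mul_le_mul_of_nonneg_right hPn (norm_nonneg _))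
    simp only [mulVec_mulVec] at h1
    rw [← hP] at h1
    rw [inv_mul_eq_div, le_div_iff₀ (by linarith), mul_comm]
    refine (h1.trans ?_)
    simpa using h2
  -- the first term alone satisfies `A N = D`; the second makes `A` skew-adjoint and vanishes on `N`
  set A := D * B - (D * B)ᴴ * (1 - P) with hA
  have hAN : A * N = D := by
    rw [hA, Matrix.sub_mul, Matrix.mul_assoc, hBN, Matrix.mul_one, Matrix.mul_assoc,
      Matrix.sub_mul, hP,
      Matrix.mul_assoc, hBN]
    simp
  have hAs : Aᴴ = -A := by
    have h1 : P * (D * B) = -((D * B)ᴴ * P) := by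
      rw [conjTranspose_mul, hP, hB]
      simp only [conjTranspose_mul, conjTranspose_nonsing_inv, conjTranspose_conjTranspose,
        Matrix.mul_assoc]
      rw [← Matrix.mul_assoc Nᴴ D, hND]
      simp only [Matrix.mul_assoc, Matrix.neg_mul, Matrix.mul_neg]
    rw [hA]
    generalize D * B = C at h1 ⊢
    rw [conjTranspose_sub, conjTranspose_mul _ (1 - P), conjTranspose_conjTranspose,
      conjTranspose_sub,
      conjTranspose_one, hPs, Matrix.mul_sub, Matrix.sub_mul, Matrix.mul_one, Matrix.one_mul, h1]
    abel
  -- `2 ε / (2 - ε) ≤ 9 / 8 ε`, as `ε ≤ 1 / 8` gives `2 - ε ≥ 16 / 9`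
  have hAn : ‖A‖ ≤ 9 / 8 * ε := by
    have h1 : ‖D * B‖ ≤ ε * (2 - ε)⁻¹ := (l2_opNorm_mul _ _).trans (by gcongr)
    have h2 : ‖(D * B)ᴴ * (1 - P)‖ ≤ ε * (2 - ε)⁻¹ := by
      refine (l2_opNorm_mul _ _).trans ?_
      rw [l2_opNorm_conjTranspose]
      nlinarith [norm_nonneg (D * B), norm_nonneg (1 - P)]
    have h3 : (2 - ε)⁻¹ ≤ 9 / 16 := by
      rw [inv_le_comm₀ (by linarith) (by norm_num)]
      linarith
    have := norm_sub_le (D * B) ((D * B)ᴴ * (1 - P))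
    nlinarith
  clear_value A
  have hu : IsUnit (1 - A) := isUnit_one_sub_of_norm_lt_one (by linarith)
  have hud := (Matrix.isUnit_iff_isUnit_det _).mp hu
  set U := (1 - A)⁻¹ * (1 + A) with hU
  have hAU : (1 - A) * U = 1 + A := by rw [hU, ← Matrix.mul_assoc, mul_nonsing_inv _ hud,
    Matrix.one_mul]
  have hUU : U ∈ Matrix.unitaryGroup m ℂ := by
    rw [mem_unitaryGroup_iff, star_eq_conjTranspose]
    have h1 : (1 - A) * (U * Uᴴ) * (1 - A)ᴴ = (1 - A) * 1 * (1 - A)ᴴ := by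
      rw [Matrix.mul_assoc, Matrix.mul_assoc, ← conjTranspose_mul, ← Matrix.mul_assoc, hAU]
      simp only [conjTranspose_add, conjTranspose_sub, conjTranspose_one, hAs]
      noncomm_ring
    have hu' : IsUnit (1 - A)ᴴ := hu.star
    exact hu.mul_left_cancel (hu'.mul_right_cancel h1)
  refine ⟨U, hUU, ?_, ?_⟩
  · have h1 : (1 - A) * (U * J) = (1 - A) * F := by
      have h2 : A * J + A * F = F - J := by rw [← Matrix.mul_add, ← hN, hAN, hD]
      rw [← Matrix.mul_assoc, hAU, Matrix.add_mul, Matrix.sub_mul, Matrix.one_mul, Matrix.one_mul,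
        eq_sub_iff_add_eq, add_assoc, h2]
      abel
    have h3 := congrArg ((1 - A)⁻¹ * ·) h1
    simpa only [← Matrix.mul_assoc, nonsing_inv_mul _ hud, Matrix.one_mul] using h3
  · have h1 : U - 1 = A * (U + 1) := by
      have : U - A * U = 1 + A := by simpa [Matrix.sub_mul] using hAU
      rw [Matrix.mul_add, Matrix.mul_one, sub_eq_iff_eq_add, add_assoc, add_comm A 1, ← this]
      abel
    rw [h1]
    have h2 : ‖U + 1‖ ≤ 2 := by
      refine (norm_add_le _ _).trans ?_
      rw [CStarRing.norm_of_mem_unitary hUU, norm_one]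
      norm_num
    refine (l2_opNorm_mul _ _).trans ?_
    nlinarith [norm_nonneg A, norm_nonneg (U + 1)]

/-! ### Controlled circuits -/

noncomputable section

variable {ι κ : Type} [Fintype ι] [DecidableEq ι] [Fintype κ] [DecidableEq κ]

@[simp] lemma place_refl (M : QOp ι) : place (Function.Embedding.refl ι) M = M := by
  refine ext_app fun φ => ?_
  ext x
  rw [place_app, app_apply]
  refine Finset.sum_congr rfl fun v _ => ?_
  congr 1
  refine congrArg φ ?_
  rw [overwrite_eq_iff]
  exact ⟨rfl, fun k hk => absurd ⟨k, rfl⟩ hk⟩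

lemma isGate_of_card_le (hc : Fintype.card ι ≤ 2) {G : QOp ι}
    (hG : G ∈ Matrix.unitaryGroup (Bits ι) ℂ) : IsGate G := by
  simpa using isGate_place (Function.Embedding.refl ι) hc hG

/-- The embedding of two distinct wires. -/
def pair (a b : κ) (h : a ≠ b) : Fin 2 ↪ κ :=
  ⟨![a, b], by intro i j; fin_cases i <;> fin_cases j <;> simp [h, h.symm]⟩

@[simp] lemma pair_zero (a b : κ) (h : a ≠ b) : pair a b h 0 = a := rfl
@[simp] lemma pair_one (a b : κ) (h : a ≠ b) : pair a b h 1 = b := rfl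

lemma diagonal_app (d : Bits ι → ℂ) (φ : QState ι) (x : Bits ι) :
    QOp.app (Matrix.diagonal d) φ x = d x * φ x := by
  simp [app_apply, Matrix.diagonal_apply]

lemma place_diagonal (f : ι ↪ κ) (d : Bits ι → ℂ) :
    place f (Matrix.diagonal d) = Matrix.diagonal fun x => d (x ∘ f) := by
  refine ext_app fun φ => ?_
  ext x
  simp [place_app, diagonal_app, Matrix.diagonal_apply]

lemma diagonal_mem_unitary {d : Bits ι → ℂ} (hd : ∀ x, ‖d x‖ = 1) :
    Matrix.diagonal d ∈ Matrix.unitaryGroup (Bits ι) ℂ := by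
  rw [Matrix.mem_unitaryGroup_iff, Matrix.star_eq_conjTranspose, Matrix.diagonal_conjTranspose,
    Matrix.diagonal_mul_diagonal, ← Matrix.diagonal_one]
  congr 1
  ext x
  simp [Complex.mul_conj, Complex.normSq_eq_norm_sq, hd]

lemma isGate_diagonal (f : ι ↪ κ) (hc : Fintype.card ι ≤ 2) {d : Bits ι → ℂ}
    (hd : ∀ x, ‖d x‖ = 1) : IsGate (Matrix.diagonal fun x : Bits κ => d (x ∘ f) : QOp κ) := by
  rw [← place_diagonal]
  exact isGate_place f hc (diagonal_mem_unitary hd)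

/-- The operator permuting the computational basis states by `π`. -/
def permOp (π : Equiv.Perm (Bits ι)) : QOp ι := fun x y => if π.symm x = y then 1 else 0

lemma permOp_app (π : Equiv.Perm (Bits ι)) (φ : QState ι) (x : Bits ι) :
    (permOp π).app φ x = φ (π.symm x) := by
  simp [app_apply, permOp]

lemma permOp_mul (π ρ : Equiv.Perm (Bits ι)) : permOp (π * ρ) = permOp π * permOp ρ := by
  refine ext_app fun φ => ?_
  ext x
  rw [mul_app, permOp_app, permOp_app, permOp_app]
  rfl

lemma permOp_one : permOp (1 : Equiv.Perm (Bits ι)) = 1 := by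
  refine ext_app fun φ => ?_
  ext x
  rw [permOp_app, one_app]
  rfl

lemma star_permOp (π : Equiv.Perm (Bits ι)) : star (permOp π) = permOp π⁻¹ := by
  ext x y
  have : π.symm y = x ↔ π x = y := by rw [Equiv.symm_apply_eq, eq_comm]
  change star (permOp π y x) = _
  by_cases h : π x = y
  · simp [permOp, Equiv.Perm.inv_def, this, h]
  · simp [permOp, Equiv.Perm.inv_def, this, h]

lemma permOp_mem_unitary (π : Equiv.Perm (Bits ι)) :
    permOp π ∈ Matrix.unitaryGroup (Bits ι) ℂ := by
  rw [Matrix.mem_unitaryGroup_iff, star_permOp, ← permOp_mul, mul_inv_cancel, permOp_one]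

lemma isGate_permOp (f : ι ↪ κ) (hc : Fintype.card ι ≤ 2) (π : Equiv.Perm (Bits ι))
    (ρ : Equiv.Perm (Bits κ)) (h : ∀ x, ρ.symm x = overwrite f x (π.symm (x ∘ f))) :
    IsGate (permOp ρ) := by
  have : permOp ρ = place f (permOp π) := by
    refine ext_app fun φ => ?_
    ext x
    rw [permOp_app, place_app, h]
    simp [permOp]
  rw [this]
  exact isGate_place f hc (permOp_mem_unitary π)

/-- The classical controlled-not map on bits, with control `a` and target `b`. -/
def cnot (a b : κ) (h : a ≠ b) : Equiv.Perm (Bits κ) :=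
  Function.Involutive.toPerm (fun x => Function.update x b (xor (x b) (x a))) fun x => by
    ext i
    rcases eq_or_ne i b with rfl | hi
    · simp [h]
    · simp [hi]

lemma cnot_apply (a b : κ) (h : a ≠ b) (x : Bits κ) :
    cnot a b h x = Function.update x b (xor (x b) (x a)) := rfl

lemma cnot_symm (a b : κ) (h : a ≠ b) : (cnot a b h).symm = cnot a b h := rfl

lemma overwrite_pair (a b : κ) (h : a ≠ b) (x : Bits κ) (v : Bits (Fin 2)) :
    overwrite (pair a b h) x v = Function.update (Function.update x a (v 0)) b (v 1) := by
  rw [overwrite_eq_iff]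
  constructor
  · ext i
    fin_cases i
    · change Function.update (Function.update x a (v 0)) b (v 1) a = v 0
      simp [h]
    · change Function.update (Function.update x a (v 0)) b (v 1) b = v 1
      simp
  · intro k hk
    have h1 : k ≠ a := fun h' => hk ⟨0, h'.symm⟩
    have h2 : k ≠ b := fun h' => hk ⟨1, h'.symm⟩
    simp [h1, h2]

lemma isGate_cnot (a b : κ) (h : a ≠ b) : IsGate (permOp (cnot a b h)) := by
  refine isGate_permOp (pair a b h) (by simp) (cnot 0 1 (by simp)) _ fun x => ?_
  rw [cnot_symm, cnot_symm, overwrite_pair, cnot_apply, cnot_apply]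
  simp

/-- The map of bit strings that moves the bit of the wire `k` to the wire `σ k`. -/
def wirePerm (σ : Equiv.Perm κ) : Equiv.Perm (Bits κ) := Equiv.arrowCongr σ (Equiv.refl Bool)

lemma wirePerm_apply (σ : Equiv.Perm κ) (x : Bits κ) : wirePerm σ x = x ∘ σ.symm := rfl
lemma wirePerm_symm_apply (σ : Equiv.Perm κ) (x : Bits κ) : (wirePerm σ).symm x = x ∘ σ := rfl

lemma wirePerm_mul (σ τ : Equiv.Perm κ) : wirePerm (σ * τ) = wirePerm σ * wirePerm τ := by
  ext x i
  rfl

lemma isGate_wirePerm_swap (a b : κ) (h : a ≠ b) : IsGate (permOp (wirePerm (Equiv.swap a b))) := by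
  refine isGate_permOp (pair a b h) (by simp) (wirePerm (Equiv.swap 0 1)) _ fun x => ?_
  rw [overwrite_pair, wirePerm_symm_apply, wirePerm_symm_apply]
  ext i
  rcases eq_or_ne i b with rfl | hb
  · simp
  · rcases eq_or_ne i a with rfl | ha
    · simp [hb]
    · simp [hb, ha, Equiv.swap_apply_of_ne_of_ne]

/-- The operator `M` controlled by the wire `none`. -/
def ctrl (M : QOp ι) : QOp (Option ι) :=
  fun x y => if x none then place Function.Embedding.some M x y else (1 : QOp (Option ι)) x y

lemma ctrl_app (M : QOp ι) (φ : QState (Option ι)) (x : Bits (Option ι)) :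
    (ctrl M).app φ x = if x none then (place Function.Embedding.some M).app φ x else φ x := by
  rw [app_apply]
  unfold ctrl
  split_ifs with h
  · rw [app_apply]
  · rw [← app_apply, one_app]

lemma overwrite_some_none (x : Bits (Option ι)) (v : Bits ι) :
    overwrite Function.Embedding.some x v none = x none :=
  overwrite_of_notMem _ _ _ (by simp)

lemma ctrl_mul (M N : QOp ι) : ctrl (M * N) = ctrl M * ctrl N := by
  refine ext_app fun φ => ?_
  ext x
  rw [mul_app, ctrl_app, ctrl_app]
  split_ifs with h
  · rw [place_mul, mul_app, place_app, place_app]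
    refine Finset.sum_congr rfl fun v _ => ?_
    rw [ctrl_app, overwrite_some_none, if_pos h]
  · rw [ctrl_app, if_neg h]

@[simp] lemma ctrl_one : ctrl (1 : QOp ι) = 1 := by
  refine ext_app fun φ => ?_
  ext x
  simp [ctrl_app]

lemma ctrl_star (M : QOp ι) : ctrl (star M) = star (ctrl M) := by
  ext x y
  change _ = star (ctrl M y x)
  unfold ctrl
  rw [place_star]
  by_cases hxy : x none = y none
  · rw [hxy]
    split_ifs
    · rfl
    · simp [Matrix.one_apply, eq_comm]
  · have h1 : ∀ (N : QOp ι), ∀ a b : Bits (Option ι), a none ≠ b none → place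
      Function.Embedding.some N a b = 0 := by
      intro N a b hab
      rw [place, if_neg]
      intro h
      apply hab
      rw [h, overwrite_some_none]
    have h2 : x ≠ y := fun h => hxy (by rw [h])
    rw [← place_star, h1 _ _ _ hxy, h1 _ _ _ (Ne.symm hxy)]
    simp [h2, h2.symm]

lemma ctrl_mem_unitary {M : QOp ι} (hM : M ∈ Matrix.unitaryGroup (Bits ι) ℂ) :
    ctrl M ∈ Matrix.unitaryGroup (Bits (Option ι)) ℂ := by
  rw [Matrix.mem_unitaryGroup_iff] at hM ⊢
  rw [← ctrl_star, ← ctrl_mul, hM, ctrl_one]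

lemma norm_ctrl_sub_le (M N : QOp ι) : ‖ctrl M - ctrl N‖ ≤ ‖M - N‖ := by
  have h : ctrl M - ctrl N = (Matrix.diagonal fun x : Bits (Option ι) =>
      if x none then (1 : ℂ) else 0) *
      (place Function.Embedding.some M - place Function.Embedding.some N) := by
    refine ext_app fun φ => ?_
    ext x
    rw [sub_app, mul_app, diagonal_app, sub_app, PiLp.sub_apply, ctrl_app, ctrl_app]
    split_ifs <;> simp
  rw [h]
  refine (Matrix.l2_opNorm_mul _ _).trans ?_
  rw [Matrix.l2_opNorm_diagonal]
  refine (mul_le_of_le_one_left (norm_nonneg _) ?_).trans (norm_place_sub_le _ _ _)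
  rw [pi_norm_le_iff_of_nonneg zero_le_one]
  intro x
  split_ifs <;> simp

lemma ctrl_place (f : ι ↪ κ) (M : QOp ι) : ctrl (place f M) = place f.optionMap (ctrl M) := by
  refine ext_app fun φ => ?_
  ext x
  rw [ctrl_app, place_place, place_app, place_app]
  have h0 : (x ∘ f.optionMap) none = x none := rfl
  by_cases h : x none
  · simp only [if_pos h, ctrl, h0, place, ite_mul, zero_mul]
    rw [sum_overwrite Function.Embedding.some (x ∘ f.optionMap) fun y => M
      ((x ∘ f.optionMap) ∘ Function.Embedding.some) (y ∘ Function.Embedding.some) * φ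
      (overwrite f.optionMap x y)]
    refine Finset.sum_congr rfl fun v _ => ?_
    rw [overwrite_comp]
    congr 1
    refine congrArg φ ?_
    rw [overwrite_eq_iff]
    constructor
    · ext i
      exact overwrite_apply f.optionMap x _ (some i) |>.trans (overwrite_apply _ _ v i)
    · intro k hk
      by_cases hk' : k ∈ Set.range f.optionMap
      · obtain ⟨j, rfl⟩ := hk'
        rw [overwrite_apply]
        cases j with
        | none => rw [overwrite_some_none]; rfl
        | some j => exact absurd ⟨j, rfl⟩ hk
      · rw [overwrite_of_notMem _ _ _ hk']
  · have h1 := overwrite_self f.optionMap x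
    have h2 : ∀ v, ctrl M (x ∘ f.optionMap) v =
        (1 : QOp (Option ι)) (x ∘ f.optionMap) v := fun v => by
      unfold ctrl
      rw [h0, if_neg h]
    simp only [if_neg h, h2, Matrix.one_apply, ite_mul, one_mul, zero_mul, Finset.sum_ite_eq,
      Finset.mem_univ, if_true, h1]

lemma ctrl_diagonal (d : Bits ι → ℂ) : ctrl (Matrix.diagonal d) =
    Matrix.diagonal fun x : Bits (Option ι) => if x none then d (x ∘ some) else 1 := by
  refine ext_app fun φ => ?_
  ext x
  rw [ctrl_app, place_diagonal, diagonal_app, diagonal_app]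
  split_ifs
  · rfl
  · simp

/-- A diagonal two-qubit operator, controlled by a third qubit. Up to a square root, a phase
function of two bits is a product of functions of the first bit, of the second, and of their sum;
the last one is a one-bit phase between two controlled-not gates. -/
lemma hasCircuit_ctrl_diagonal (d : Bits (Fin 2) → ℂ) (hd : ∀ x, ‖d x‖ = 1) :
    HasCircuit (ctrl (Matrix.diagonal d)) 5 := by
  have hd0 : ∀ x, d x ≠ 0 := fun x h => by simpa [h] using hd x
  obtain ⟨w, hw⟩ := IsAlgClosed.exists_pow_nat_eq
    (d ![true, false] * d ![false, true] / (d ![false, false] * d ![true, true]))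
      (n := 2) (by norm_num)
  have hwn : ‖w‖ = 1 := by
    have := congrArg norm hw
    simp only [norm_pow, norm_div, norm_mul, hd] at this
    exact (pow_eq_one_iff_of_nonneg (norm_nonneg w) two_ne_zero).mp (by simpa using this)
  have hw0 : w ≠ 0 := fun h => by simp [h] at hwn
  have hab : (some 0 : Option (Fin 2)) ≠ some 1 := by simp
  have key : ctrl (Matrix.diagonal d) =
      (Matrix.diagonal fun x : Bits (Option (Fin 2)) => if x none then (if x (some 0) then
        d ![true, false] / (d ![false, false] * w) else 1) else 1 : QOp (Option (Fin 2))) *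
      (Matrix.diagonal fun x : Bits (Option (Fin 2)) => if x none then (if x (some 1) then
        d ![false, true] / w else d ![false, false]) else 1 : QOp (Option (Fin 2))) *
      permOp (cnot (some 0) (some 1) hab) *
      (Matrix.diagonal fun x : Bits (Option (Fin 2)) => if x none then (if x (some 1) then
        w else 1) else 1 : QOp (Option (Fin 2))) *
      permOp (cnot (some 0) (some 1) hab) := by
    refine ext_app fun φ => ?_
    ext x
    simp only [mul_app, ctrl_diagonal, diagonal_app, permOp_app]
    have hinv : (cnot (some 0) (some 1) hab).symm ((cnot (some 0) (some 1) hab).symm x) = x :=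
      (cnot (some 0) (some 1) hab).symm_apply_apply x
    rw [hinv, cnot_symm, cnot_apply]
    have hx : x ∘ some = ![x (some 0), x (some 1)] := by
      ext i; fin_cases i <;> rfl
    rw [hx]
    have h00 := hd0 ![false, false]
    have h11 := hd0 ![true, true]
    cases hc : x none
    · simp [hc]
    · cases x (some 0) <;> cases x (some 1) <;> simp [hc]
      · field_simp
      · field_simp
      · field_simp
        rw [hw]
        field_simp
  have hg : ∀ (a : Fin 2) (g : Bool → Bool → ℂ), (∀ b c, ‖g b c‖ = 1) →
      HasCircuit (Matrix.diagonal fun x : Bits (Option (Fin 2)) => g (x none) (x (some a))) 1 :=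
    fun a g hg => IsGate.hasCircuit <| isGate_diagonal (pair none (some a) (by simp)) (by simp)
      (d := fun y => g (y 0) (y 1)) fun y => hg _ _
  rw [key]
  refine (((HasCircuit.mul (s := 1) (t := 1) ?_ ?_).mul (isGate_cnot _ _ _).hasCircuit).mul
    (t := 1) ?_).mul (isGate_cnot _ _ _).hasCircuit
  · refine hg 0 (fun b c => if b then (if c then _ else _) else _) fun b c => ?_
    split_ifs <;> simp [hd, hwn]
  · refine hg 1 (fun b c => if b then (if c then _ else _) else _) fun b c => ?_
    split_ifs <;> simp [hd, hwn]
  · refine hg 1 (fun b c => if b then (if c then _ else _) else _) fun b c => ?_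
    split_ifs <;> simp [hwn]

/-- With `G = W d W⁻¹` and `d` diagonal, only `d` has to be controlled: if the control is off, `W`
and `W⁻¹` cancel. -/
lemma hasCircuit_ctrl_of_unitary {G : QOp (Fin 2)} (hG : G ∈ Matrix.unitaryGroup (Bits (Fin 2)) ℂ) :
    HasCircuit (ctrl G) 7 := by
  obtain ⟨W, hW, d, hd, rfl⟩ := Matrix.exists_diagonalization_of_unitary hG
  rw [ctrl_mul, ctrl_mul]
  have h1 : ctrl W * ctrl (Matrix.diagonal d) * ctrl (star W) =
      place Function.Embedding.some W * ctrl (Matrix.diagonal d) *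
          place Function.Embedding.some (star W) := by
    refine ext_app fun φ => ?_
    ext x
    have hn : (place Function.Embedding.some (W * star W)).app φ x = φ x := by
      rw [Unitary.mul_star_self_of_mem hW, place_one, one_app]
    rw [place_mul, mul_app] at hn
    simp only [mul_app]
    rw [ctrl_app]
    rw [place_app] at hn ⊢
    simp only [place_app (M := W), ctrl_app (M := Matrix.diagonal d), overwrite_some_none]
    split_ifs with h
    · refine Finset.sum_congr rfl fun v _ => ?_
      congr 1
      simp only [place_app (M := Matrix.diagonal d), overwrite_some_none, ctrl_app, if_pos h]
    · rw [ctrl_app, if_neg h]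
      exact hn.symm
  rw [h1]
  have hg := fun {V : QOp (Fin 2)} (hV : V ∈ Matrix.unitaryGroup (Bits (Fin 2)) ℂ) =>
    (isGate_place Function.Embedding.some (by simp) hV).hasCircuit
  exact ((hg hW).mul (hasCircuit_ctrl_diagonal d hd)).mul (hg (Unitary.star_mem hW))

lemma IsGate.hasCircuit_ctrl {G : QOp ι} (hG : IsGate G) : HasCircuit (ctrl G) 7 := by
  obtain ⟨S, hS, G, hG, rfl⟩ := hG
  rw [extendGate_eq_place, ctrl_place]
  refine HasCircuit.place ?_ _
  rcases hS.lt_or_eq with hlt | heq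
  · refine (IsGate.hasCircuit (isGate_of_card_le ?_ (ctrl_mem_unitary hG))).mono (by norm_num)
    simp only [Fintype.card_option, Fintype.card_coe]
    omega
  · let e : S ≃ Fin 2 := Fintype.equivFinOfCardEq (by simpa using heq)
    have : G = _root_.place e.symm.toEmbedding (_root_.place e.toEmbedding G) := by
      rw [place_place]
      convert (place_refl G).symm
      ext x
      simp
    rw [this, ctrl_place]
    exact (hasCircuit_ctrl_of_unitary (place_mem_unitary _ hG)).place _

lemma HasCircuit.ctrl {M : QOp ι} {s : ℕ} (hM : HasCircuit M s) : HasCircuit (ctrl M) (s * 7) :=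
  hM.map _root_.ctrl ctrl_one ctrl_mul fun _ hG => hG.hasCircuit_ctrl

end

/-! ### Exact implementations near approximate ones -/

noncomputable section

variable {ι κ : Type} [Fintype ι] [DecidableEq ι] [Fintype κ] [DecidableEq κ]

lemma smul_app (a : ℂ) (M : QOp ι) (φ : QState ι) : QOp.app (a • M) φ = a • M.app φ := by
  simp [QOp.app]

lemma app_smul (a : ℂ) (M : QOp ι) (φ : QState ι) : M.app (a • φ) = a • M.app φ := by
  simp [QOp.app]

lemma norm_app_le (M : QOp ι) (φ : QState ι) : ‖M.app φ‖ ≤ ‖M‖ * ‖φ‖ :=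
  Matrix.l2_opNorm_mulVec M φ

lemma basisKet_apply (b x : Bits ι) : basisKet b x = if x = b then 1 else 0 := by
  simp [basisKet]

lemma zeroKet_apply (x : Bits ι) : zeroKet ι x = if x = fun _ => false then 1 else 0 :=
  basisKet_apply _ _

lemma tensorState_apply (ψ : QState ι) (φ : QState κ) (x : Bits (ι ⊕ κ)) :
    tensorState ψ φ x = ψ (x ∘ Sum.inl) * φ (x ∘ Sum.inr) := rfl

lemma tensorState_smul_left (a : ℂ) (ψ : QState ι) (φ : QState κ) :
    tensorState (a • ψ) φ = a • tensorState ψ φ := by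
  ext x
  simp [tensorState_apply, mul_assoc]

lemma tensorId_eq_place (M : QOp ι) :
    tensorId κ M = place (Function.Embedding.inl : ι ↪ ι ⊕ κ) M := by
  ext x y
  simp only [tensorId, place]
  congr 1
  rw [eq_comm (a := y), overwrite_eq_iff]
  simp [funext_iff]

lemma place_app_eq (f : ι ↪ κ) (M : QOp ι) (φ : QState κ) (x : Bits κ) :
    (place f M).app φ x = M.app (WithLp.toLp 2 fun v => φ (overwrite f x v)) (x ∘ f) := by
  rw [place_app, app_apply]

lemma overwrite_inl (x : Bits (ι ⊕ κ)) (v : Bits ι) :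
    overwrite (Function.Embedding.inl : ι ↪ ι ⊕ κ) x v = Sum.elim v (x ∘ Sum.inr) := by
  rw [overwrite_eq_iff]
  constructor
  · rfl
  · rintro (i | k) h
    · exact absurd ⟨i, rfl⟩ h
    · rfl

lemma overwrite_inr (x : Bits (ι ⊕ κ)) (v : Bits κ) :
    overwrite (Function.Embedding.inr : κ ↪ ι ⊕ κ) x v = Sum.elim (x ∘ Sum.inl) v := by
  rw [overwrite_eq_iff]
  constructor
  · rfl
  · rintro (i | k) h
    · rfl
    · exact absurd ⟨k, rfl⟩ h

lemma place_inl_app_tensorState (M : QOp ι) (ψ : QState ι) (φ : QState κ) :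
    (place Function.Embedding.inl M).app (tensorState ψ φ) = tensorState (M.app ψ) φ := by
  ext x
  rw [place_app, tensorState_apply, app_apply, Finset.sum_mul]
  refine Finset.sum_congr rfl fun v _ => ?_
  rw [overwrite_inl, tensorState_apply, ← mul_assoc]
  rfl

lemma place_inr_app_tensorState (M : QOp κ) (ψ : QState ι) (φ : QState κ) :
    (place Function.Embedding.inr M).app (tensorState ψ φ) = tensorState ψ (M.app φ) := by
  ext x
  rw [place_app, tensorState_apply, app_apply, Finset.mul_sum]
  refine Finset.sum_congr rfl fun v _ => ?_
  rw [overwrite_inr, tensorState_apply, mul_left_comm]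
  rfl

lemma NormalizedHamiltonian.evolution_mem_unitary {n : ℕ} (H : NormalizedHamiltonian n) (t : ℝ) :
    H.evolution t ∈ Matrix.unitaryGroup (Bits (Fin n)) ℂ := by
  let _ : NormedAlgebra ℚ (QOp (Fin n)) := NormedAlgebra.restrictScalars ℚ ℂ _
  refine NormedSpace.exp_mem_unitary_of_mem_skewAdjoint ?_
  rw [skewAdjoint.mem_iff, star_smul, Matrix.star_eq_conjTranspose, H.isHermitian.eq]
  simp

lemma NormalizedHamiltonian.evolution_app {n : ℕ} (H : NormalizedHamiltonian n) (t : ℝ) {E : ℝ}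
    {ψ : QState (Fin n)} (hψ : H.op.app ψ = (E : ℂ) • ψ) :
    (H.evolution t).app ψ = Complex.exp (-(Complex.I * t * E)) • ψ := by
  set X : QOp (Fin n) := (-(Complex.I * (t : ℂ))) • H.op with hX
  have hXψ : X.app ψ = (-(Complex.I * t * E)) • ψ := by
    rw [hX, smul_app, hψ, smul_smul]
    ring_nf
  have hpow : ∀ k : ℕ, QOp.app (X ^ k) ψ = (-(Complex.I * t * E)) ^ k • ψ := fun k => by
    induction k with
    | zero => simp
    | succ k ih => rw [pow_succ, mul_app, hXψ, app_smul, ih, smul_smul, ← pow_succ']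
  let L : QOp (Fin n) →ₗ[ℂ] QState (Fin n) :=
    { toFun := fun M => M.app ψ
      map_add' := fun M N => add_app M N ψ
      map_smul' := fun a M => smul_app a M ψ }
  have h1 := (NormedSpace.exp_series_hasSum_exp' (𝕂 := ℂ) X).mapL
    (LinearMap.toContinuousLinearMap L)
  have h2 := (NormedSpace.exp_series_hasSum_exp' (𝕂 := ℂ) (-(Complex.I * t * E))).smul_const ψ
  rw [← Complex.exp_eq_exp_ℂ] at h2
  refine h1.unique (h2.congr_fun fun k => ?_)
  change QOp.app _ _ = _
  rw [smul_app, hpow, smul_smul, smul_eq_mul]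

lemma norm_sub_le_two {M N : QOp ι} (hM : M ∈ Matrix.unitaryGroup (Bits ι) ℂ)
    (hN : N ∈ Matrix.unitaryGroup (Bits ι) ℂ) : ‖M - N‖ ≤ 2 := by
  refine (norm_sub_le _ _).trans ?_
  rw [CStarRing.norm_of_mem_unitary hM, CStarRing.norm_of_mem_unitary hN]
  norm_num

/-- The distance in operator norm from a circuit that simulates an evolution to within `α` to a
unitary that performs it exactly. The linear bound is available for `α ≤ 1 / 8` only; `2` is the
trivial bound. -/
def queryError (α : ℝ) : ℝ := if α ≤ 1 / 8 then 9 / 4 * α else 2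

/-- The isometry `ψ ↦ ψ ⊗ |0⟩`. -/
def appendZero (ι κ : Type) [DecidableEq ι] [Fintype ι] [DecidableEq κ] [Fintype κ] :
    Matrix (Bits (ι ⊕ κ)) (Bits ι) ℂ :=
  fun x y => if x ∘ Sum.inl = y then zeroKet κ (x ∘ Sum.inr) else 0

lemma toEuclideanLin_appendZero (ψ : QState ι) :
    Matrix.toEuclideanLin (appendZero ι κ) ψ = tensorState ψ (zeroKet κ) := by
  ext x
  simp [Matrix.toEuclideanLin, Matrix.mulVec, dotProduct, appendZero, tensorState_apply, mul_comm]

open Matrix in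
lemma appendZero_isometry : (appendZero ι κ)ᴴ * appendZero ι κ = 1 := by
  ext a b
  rw [Matrix.mul_apply]
  rw [Finset.sum_eq_single (Sum.elim a fun _ => false)]
  · simp [appendZero, Matrix.one_apply, zeroKet_apply]
  · intro x _ hx
    simp only [conjTranspose_apply, appendZero, zeroKet_apply]
    have : x ∘ Sum.inl = a → x ∘ Sum.inr ≠ fun _ => false := by
      rintro rfl h
      apply hx
      ext (i | i)
      · rfl
      · exact congrFun h i
    by_cases h : x ∘ Sum.inl = a
    · simp [this h]
    · simp [h]
  · simp

open Matrix in
lemma place_inl_mul_appendZero (X : QOp ι) :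
    place (Function.Embedding.inl : ι ↪ ι ⊕ κ) X * appendZero ι κ = appendZero ι κ * X := by
  refine Matrix.toEuclideanLin.injective (LinearMap.ext fun ψ => ?_)
  have h1 : ∀ M : QOp (ι ⊕ κ), Matrix.toEuclideanLin (M * appendZero ι κ) ψ =
      M.app (Matrix.toEuclideanLin (appendZero ι κ) ψ) := fun M => by
    simp [Matrix.toEuclideanLin, QOp.app]
  have h2 : Matrix.toEuclideanLin (appendZero ι κ * X) ψ =
      Matrix.toEuclideanLin (appendZero ι κ) (X.app ψ) := by
    simp [Matrix.toEuclideanLin, QOp.app]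
  rw [h1, h2, toEuclideanLin_appendZero, toEuclideanLin_appendZero, place_inl_app_tensorState]

open Matrix in
/-- A unitary `V` that acts approximately as `X ⊗ 1` on the states with ancillas `0` is close, on
the whole space, to a unitary `U` that acts exactly so on these states. -/
lemma exists_exact_near_approximate {X : QOp ι} (hX : X ∈ Matrix.unitaryGroup (Bits ι) ℂ)
    {V : QOp (ι ⊕ κ)} (hV : V ∈ Matrix.unitaryGroup (Bits (ι ⊕ κ)) ℂ) {α : ℝ}
    (h : ∀ ψ : QState ι, ‖ψ‖ = 1 →
      ‖(tensorId κ X - V).app (tensorState ψ (zeroKet κ))‖ ≤ α) :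
    ∃ U ∈ Matrix.unitaryGroup (Bits (ι ⊕ κ)) ℂ, ‖U - V‖ ≤ queryError α ∧
      ∀ ψ, QOp.app U (tensorState ψ (zeroKet κ)) = tensorState (X.app ψ) (zeroKet κ) := by
  rw [tensorId_eq_place] at h
  by_cases hα : α ≤ 1 / 8
  · have hα0 : 0 ≤ α := (norm_nonneg _).trans (h (zeroKet ι) (by simp [zeroKet, basisKet]))
    have hXX : Xᴴ * X = 1 := Unitary.star_mul_self_of_mem hX
    have hVV : Vᴴ * V = 1 := Unitary.star_mul_self_of_mem hV
    have h1 : (appendZero ι κ * X)ᴴ * (appendZero ι κ * X) = 1 := by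
      rw [conjTranspose_mul, Matrix.mul_assoc, ← Matrix.mul_assoc (appendZero ι κ)ᴴ,
        appendZero_isometry, Matrix.one_mul, hXX]
    have h2 : (V * appendZero ι κ)ᴴ * (V * appendZero ι κ) = 1 := by
      rw [conjTranspose_mul, Matrix.mul_assoc, ← Matrix.mul_assoc Vᴴ, hVV, Matrix.one_mul,
        appendZero_isometry]
    have h3 : ‖appendZero ι κ * X - V * appendZero ι κ‖ ≤ α := by
      rw [← place_inl_mul_appendZero, ← Matrix.sub_mul, l2_opNorm_def]
      refine ContinuousLinearMap.opNorm_le_of_unit_norm hα0 fun ψ hψ => ?_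
      refine le_trans (le_of_eq ?_) (h ψ hψ)
      congr 1
      rw [← toEuclideanLin_appendZero]
      simp [Matrix.toEuclideanLin, QOp.app]
    obtain ⟨U, hU, hUJ, hUn⟩ := exists_unitary_extension h2 h1 hα h3
    refine ⟨U * V, mul_mem hU hV, ?_, fun ψ => ?_⟩
    · rw [queryError, if_pos hα]
      have : U * V - V = (U - 1) * V := by rw [Matrix.sub_mul, Matrix.one_mul]
      rw [this, CStarRing.norm_mul_mem_unitary _ hV]
      exact hUn
    · rw [← Matrix.mul_assoc, ← place_inl_mul_appendZero] at hUJ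
      have h4 := congrArg (fun M => Matrix.toEuclideanLin M ψ) hUJ
      rw [← place_inl_app_tensorState, ← toEuclideanLin_appendZero]
      simpa [Matrix.toEuclideanLin, QOp.app] using h4
  · refine ⟨place Function.Embedding.inl X, place_mem_unitary _ hX, ?_,
      fun ψ => place_inl_app_tensorState _ _ _⟩
    rw [queryError, if_neg hα]
    exact norm_sub_le_two (place_mem_unitary _ hX) hV

end

/-! ### Operations simulated on the eigenspaces of the Hamiltonian -/

noncomputable section

variable {ι κ : Type} [Fintype ι] [DecidableEq ι] [Fintype κ] [DecidableEq κ]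

lemma norm_mul_sub_mul_le {U U' V V' : QOp ι} (hU' : U' ∈ Matrix.unitaryGroup (Bits ι) ℂ)
    (hV : V ∈ Matrix.unitaryGroup (Bits ι) ℂ) : ‖U * U' - V * V'‖ ≤ ‖U - V‖ + ‖U' - V'‖ := by
  have : U * U' - V * V' = (U - V) * U' + V * (U' - V') := by
    rw [Matrix.sub_mul, Matrix.mul_sub]
    abel
  rw [this]
  refine (norm_add_le _ _).trans (add_le_add ?_ ?_)
  · rw [CStarRing.norm_mul_mem_unitary _ hU']
  · rw [CStarRing.norm_mem_unitary_mul _ hV]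

/-- The family `A E` of operators on the wires `κ` is simulated by a circuit of size `s`, with error
`δ`: a unitary `U` at distance at most `δ` from the circuit applies `A E` to the wires `κ` while the
first register is in an eigenstate of `H` of energy `E`. It leaves this eigenstate and the `c`
ancillas, which are initially `0`, exactly as they are, so that the same ancillas serve for the next
operation. -/
def Simulable {n : ℕ} (H : NormalizedHamiltonian n) (c : ℕ) (A : ℝ → QOp κ) (s : ℕ) (δ : ℝ) :
    Prop :=
  ∃ U V : QOp (Fin n ⊕ (Fin c ⊕ κ)), U ∈ Matrix.unitaryGroup _ ℂ ∧ HasCircuit V s ∧ ‖U - V‖ ≤ δ ∧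
    ∀ (E : ℝ) (ψ : QState (Fin n)), H.op.app ψ = (E : ℂ) • ψ → ∀ Φ : QState κ,
      U.app (tensorState ψ (tensorState (zeroKet (Fin c)) Φ)) =
        tensorState ψ (tensorState (zeroKet (Fin c)) ((A E).app Φ))

namespace Simulable
variable {n c s t : ℕ} {H : NormalizedHamiltonian n} {A B : ℝ → QOp κ} {δ ε : ℝ}

lemma mul (hA : Simulable H c A s δ) (hB : Simulable H c B t ε) :
    Simulable H c (fun E => A E * B E) (s + t) (δ + ε) := by
  obtain ⟨U, V, hU, hV, hUV, hUA⟩ := hA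
  obtain ⟨U', V', hU', hV', hUV', hUB⟩ := hB
  refine ⟨U * U', V * V', mul_mem hU hU', hV.mul hV', ?_, fun E ψ hψ Φ => ?_⟩
  · exact (norm_mul_sub_mul_le hU' hV.mem_unitary).trans (add_le_add hUV hUV')
  · rw [mul_app, mul_app, hUB E ψ hψ, hUA E ψ hψ]

lemma mono (hA : Simulable H c A s δ) (hs : s ≤ t) (hδ : δ ≤ ε) : Simulable H c A t ε := by
  obtain ⟨U, V, hU, hV, hUV, hUA⟩ := hA
  exact ⟨U, V, hU, hV.mono hs, hUV.trans hδ, hUA⟩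

lemma of_hasCircuit {G : QOp κ} (hG : HasCircuit G s) : Simulable H c (fun _ => G) s 0 := by
  let f : κ ↪ Fin n ⊕ (Fin c ⊕ κ) := Function.Embedding.inr.trans Function.Embedding.inr
  refine ⟨place f G, place f G, place_mem_unitary f hG.mem_unitary, hG.place f, by simp,
    fun E ψ _ Φ => ?_⟩
  rw [← place_place, place_inr_app_tensorState, place_inr_app_tensorState]

lemma one : Simulable H c (fun _ => (1 : QOp κ)) 0 0 := of_hasCircuit HasCircuit.one

lemma list_prod {α : Type*} (l : List α) (F : α → ℝ → QOp κ) {s : α → ℕ} {δ : α → ℝ}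
    (h : ∀ a ∈ l, Simulable H c (F a) (s a) (δ a)) :
    Simulable H c (fun E => (l.map fun a => F a E).prod) (l.map s).sum (l.map δ).sum := by
  induction l with
  | nil => simpa using one
  | cons a l ih =>
    simp only [List.mem_cons, forall_eq_or_imp] at h
    simpa using h.1.mul (ih h.2)

lemma pow (hA : Simulable H c A s δ) (k : ℕ) :
    Simulable H c (fun E => A E ^ k) (k * s) (k * δ) := by
  simpa using list_prod (List.replicate k ()) (fun _ => A) fun _ _ => hA

end Simulable

/-- The evolution of an eigenstate, controlled by the wire `k`, is a phase gate on this wire. The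
simulating circuits may use different numbers `c'` of ancillas; they are given `c'` of the `c`
common ones. -/
lemma simulable_controlled_evolution {n c c' s : ℕ} (hc : c' ≤ c)
    (H : NormalizedHamiltonian n) {t α : ℝ}
    {V : QOp (Fin n ⊕ Fin c')} (hV : HasCircuit V s)
    (h : ∀ ψ : QState (Fin n), ‖ψ‖ = 1 →
      ‖(tensorId (Fin c') (H.evolution t) - V).app
        (tensorState ψ (zeroKet (Fin c')))‖ ≤ α) (k : κ) :
    Simulable H c (fun E => Matrix.diagonal fun y : Bits κ =>
      if y k then Complex.exp (-(Complex.I * t * E)) else 1) (s * 7) (queryError α) := by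
  obtain ⟨U, hU, hUV, hUX⟩ :=
    exists_exact_near_approximate (H.evolution_mem_unitary t) hV.mem_unitary h
  let f : Option (Fin n ⊕ Fin c') ↪ Fin n ⊕ (Fin c ⊕ κ) :=
    ⟨fun o => o.elim (Sum.inr (Sum.inr k)) (Sum.map id fun a => Sum.inl (Fin.castLE hc a)), by
      rintro (_ | i | a) (_ | j | b) hij <;> simp_all⟩
  refine ⟨place f (ctrl U), place f (ctrl V), place_mem_unitary f (ctrl_mem_unitary hU),
    hV.ctrl.place f,
    (norm_place_sub_le _ _ _).trans ((norm_ctrl_sub_le _ _).trans hUV), fun E ψ hψ Φ => ?_⟩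
  ext x
  rw [place_app_eq, ctrl_app]
  have hk : (x ∘ f) none = x (Sum.inr (Sum.inr k)) := rfl
  have hrhs : (tensorState ψ (tensorState (zeroKet (Fin c))
      (QOp.app (Matrix.diagonal fun y : Bits κ =>
      if y k then Complex.exp (-(Complex.I * t * E)) else 1) Φ))) x =
      (if x (Sum.inr (Sum.inr k)) then Complex.exp (-(Complex.I * t * E)) else 1) *
        tensorState ψ (tensorState (zeroKet (Fin c)) Φ) x := by
    simp only [tensorState_apply, diagonal_app, Function.comp_apply]
    ring
  rw [hrhs, hk]
  split_ifs with h1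
  -- as a function of the wires of `V`, the input is a multiple `K` of a state on which `U` is exact
  · let K : ℂ := if ∀ a : Fin c, c' ≤ a → x (Sum.inr (Sum.inl a)) = false then
      Φ ((x ∘ Sum.inr) ∘ Sum.inr) else 0
    have hK : ∀ v, tensorState ψ (tensorState (zeroKet (Fin c)) Φ)
        (overwrite f x (overwrite Function.Embedding.some (x ∘ f) v)) =
        K * tensorState ψ (zeroKet (Fin c')) v := by
      intro v
      set y := overwrite f x (overwrite Function.Embedding.some (x ∘ f) v) with hy
      have hy1 : y ∘ Sum.inl = v ∘ Sum.inl := by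
        ext i
        exact (overwrite_apply f x _ (some (Sum.inl i))).trans
          (overwrite_apply Function.Embedding.some _ v (Sum.inl i))
      have hy2 : (y ∘ Sum.inr) ∘ Sum.inr = (x ∘ Sum.inr) ∘ Sum.inr := by
        ext i
        by_cases hik : i = k
        · subst hik
          exact (overwrite_apply f x _ none).trans (overwrite_some_none _ _)
        · refine overwrite_of_notMem f _ _ ?_
          rintro ⟨(_ | i | a), hi⟩
          · exact hik (Sum.inr.inj (Sum.inr.inj hi)).symm
          · exact Sum.inl_ne_inr hi
          · exact Sum.inl_ne_inr (Sum.inr.inj hi)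
      have hy3 : ∀ a : Fin c', y (Sum.inr (Sum.inl (Fin.castLE hc a))) = v (Sum.inr a) := fun a =>
        (overwrite_apply f x _ (some (Sum.inr a))).trans
          (overwrite_apply Function.Embedding.some _ v (Sum.inr a))
      have hy4 : ∀ a : Fin c, c' ≤ a → y (Sum.inr (Sum.inl a)) = x (Sum.inr (Sum.inl a)) := by
        intro a ha
        refine overwrite_of_notMem f _ _ ?_
        rintro ⟨(_ | i | b), hi⟩
        · exact Sum.inr_ne_inl (Sum.inr.inj hi)
        · exact Sum.inl_ne_inr hi
        · have : (b : ℕ) = a := congrArg Fin.val (Sum.inl.inj (Sum.inr.inj hi))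
          omega
      have hy5 : ((y ∘ Sum.inr) ∘ Sum.inl = fun _ => false) ↔
          (∀ a : Fin c, c' ≤ a → x (Sum.inr (Sum.inl a)) = false) ∧ v ∘ Sum.inr =
              fun _ => false := by
        constructor
        · intro h0
          have h0' : ∀ a, y (Sum.inr (Sum.inl a)) = false := congrFun h0
          refine ⟨fun a ha => by rw [← hy4 a ha, h0'], funext fun a => ?_⟩
          rw [Function.comp_apply, ← hy3, h0']
        · rintro ⟨h0, h0'⟩
          ext a
          by_cases ha : c' ≤ a
          · exact (hy4 a ha).trans (h0 a ha)
          · exact (hy3 ⟨a, by omega⟩).trans (congrFun h0' _)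
      simp only [tensorState_apply, zeroKet_apply, hy1, hy2, hy5, K]
      by_cases ha : ∀ a : Fin c, c' ≤ a → x (Sum.inr (Sum.inl a)) = false
      · by_cases hb : v ∘ Sum.inr = fun _ => false
        · rw [if_pos ⟨ha, hb⟩, if_pos ha, if_pos hb]
          ring
        · simp [hb]
      · simp [ha]
    rw [place_app_eq]
    have hfun : (WithLp.toLp 2 fun v => (WithLp.toLp 2 fun v =>
        tensorState ψ (tensorState (zeroKet (Fin c)) Φ)
        (overwrite f x v)).ofLp (overwrite Function.Embedding.some (x ∘ f) v) : QState
          (Fin n ⊕ Fin c')) =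
        K • tensorState ψ (zeroKet (Fin c')) := by
      ext v
      exact hK v
    rw [hfun, app_smul, hUX, H.evolution_app t hψ, tensorState_smul_left]
    have hx := hK ((x ∘ f) ∘ Function.Embedding.some)
    rw [overwrite_self, overwrite_self] at hx
    rw [hx]
    simp only [PiLp.smul_apply, smul_eq_mul]
    ring
  · simp

lemma diagonal_pow_eq (d : Bits ι → ℂ) (k : ℕ) :
    (Matrix.diagonal d : QOp ι) ^ k = Matrix.diagonal fun x => d x ^ k := by
  rw [Matrix.diagonal_pow]
  rfl

/-- The evolution under `H` is simulated to within `α` up to the time `T`, by circuits of size `s`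
with at most `c` ancillas. -/
def SimulatedUpTo {n : ℕ} (H : NormalizedHamiltonian n) (T α : ℝ) (c s : ℕ) : Prop :=
  ∀ t : ℝ, 0 ≤ t → t ≤ T → ∃ c' : ℕ, c' ≤ c ∧ ∃ V : QOp (Fin n ⊕ Fin c'), HasCircuit V s ∧
    ∀ ψ : QState (Fin n), ‖ψ‖ = 1 →
      ‖(tensorId (Fin c') (H.evolution t) - V).app (tensorState ψ (zeroKet (Fin c')))‖ ≤ α

/-- An evolution of any length, cut into `⌈t / T⌉` equal steps. -/
lemma simulable_controlled_long_evolution {n c s : ℕ} (H : NormalizedHamiltonian n) {T α : ℝ}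
    (hT : 0 < T)
    (h : SimulatedUpTo H T α c s)
    (k : κ) {t : ℝ} (ht : 0 < t) :
    Simulable H c (fun E => Matrix.diagonal fun y : Bits κ =>
      if y k then Complex.exp (-(Complex.I * t * E)) else 1) (⌈t / T⌉₊ * (s * 7))
        (⌈t / T⌉₊ * queryError α) := by
  set N := ⌈t / T⌉₊ with hN
  have hN0 : 0 < N := Nat.ceil_pos.mpr (by positivity)
  have hNr : (0 : ℝ) < N := by exact_mod_cast hN0
  have hle : t / N ≤ T := by
    rw [div_le_iff₀ hNr, ← div_le_iff₀' hT]
    exact Nat.le_ceil _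
  obtain ⟨c', hc', V, hV, hVα⟩ := h (t / N) (by positivity) hle
  have := (simulable_controlled_evolution hc' H hV hVα k).pow N
  convert this using 2 with E
  rw [diagonal_pow_eq]
  congr 1
  ext y
  split_ifs
  · rw [← Complex.exp_nat_mul]
    congr 1
    have : (N : ℂ) ≠ 0 := by exact_mod_cast hN0.ne'
    push_cast
    field_simp
  · simp

end

/-! ### A circuit for the majority -/

noncomputable section

variable {ι κ : Type} [Fintype ι] [DecidableEq ι] [Fintype κ] [DecidableEq κ]

lemma app_basisKet (M : QOp ι) (y x : Bits ι) : M.app (basisKet y) x = M x y := by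
  simp [app_apply, basisKet_apply]

lemma place_app_basisKet (f : ι ↪ κ) {M : QOp ι} {y : Bits κ} {z : Bits ι}
    (h : M.app (basisKet (y ∘ f)) = basisKet z) :
    (place f M).app (basisKet y) = basisKet (overwrite f y z) := by
  ext x
  have h1 := congrArg (fun φ : QState ι => φ (x ∘ f)) h
  simp only [app_basisKet, basisKet_apply] at h1 ⊢
  have h2 : x = overwrite f y z ↔ y = overwrite f x (y ∘ f) ∧ x ∘ f = z := by
    rw [eq_comm, overwrite_eq_iff, @eq_comm _ y, overwrite_eq_iff]
    simp [eq_comm, and_comm]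
  simp only [place, h1, h2, ite_and]

lemma ctrl_app_basisKet_of_true {M : QOp ι} {y : Bits (Option ι)} (hy : y none = true) {z : Bits ι}
    (h : M.app (basisKet (y ∘ some)) = basisKet z) :
    (ctrl M).app (basisKet y) = basisKet (overwrite Function.Embedding.some y z) := by
  rw [← place_app_basisKet Function.Embedding.some h]
  ext x
  rw [ctrl_app]
  split_ifs with hx
  · rfl
  · rw [place_app_basisKet Function.Embedding.some h, basisKet_apply, basisKet_apply,
      if_neg, if_neg]
    · rintro rfl
      exact hx ((overwrite_some_none _ _).trans hy)
    · rintro rfl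
      exact hx hy

lemma ctrl_app_basisKet_of_false (M : QOp ι) {y : Bits (Option ι)} (hy : y none = false) :
    (ctrl M).app (basisKet y) = basisKet y := by
  ext x
  rw [ctrl_app, app_basisKet]
  split_ifs with hx
  · rw [place, if_neg, basisKet_apply, if_neg]
    · rintro rfl
      simp [hy] at hx
    · intro h
      have := congrFun h none
      rw [overwrite_some_none, hy] at this
      simp [← this] at hx
  · rfl

lemma permOp_app_basisKet (π : Equiv.Perm (Bits ι)) (y : Bits ι) :
    (permOp π).app (basisKet y) = basisKet (π y) := by
  ext x
  rw [permOp_app, basisKet_apply, basisKet_apply]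
  simp only [Equiv.symm_apply_eq]

/-- A cyclic permutation of wires is a product of transpositions, which are two-qubit gates. -/
lemma hasCircuit_wirePerm_formPerm (l : List κ) :
    HasCircuit (permOp (wirePerm l.formPerm)) l.length := by
  induction l with
  | nil =>
    have : wirePerm (1 : Equiv.Perm κ) = 1 := rfl
    simpa [this, permOp_one] using HasCircuit.one
  | cons a l ih =>
    cases l with
    | nil =>
      have : wirePerm (1 : Equiv.Perm κ) = 1 := rfl
      simpa [this, permOp_one] using HasCircuit.one.mono (Nat.zero_le 1)
    | cons b l =>
      rw [List.formPerm_cons_cons, wirePerm_mul, permOp_mul]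
      rcases eq_or_ne a b with rfl | h
      · have : wirePerm (1 : Equiv.Perm κ) = 1 := rfl
        rw [Equiv.swap_self]
        change HasCircuit (permOp (wirePerm (1 : Equiv.Perm κ)) * _) _
        rw [this, permOp_one, one_mul]
        exact ih.mono (by simp)
      · exact ((isGate_wirePerm_swap a b h).hasCircuit.mul ih).mono (by simp; omega)

/-- The negation of one bit. -/
def negate (a : κ) : Equiv.Perm (Bits κ) :=
  Function.Involutive.toPerm (fun x => Function.update x a (!x a)) fun x => by simp

lemma negate_apply (a : κ) (x : Bits κ) : negate a x = Function.update x a (!x a) := rfl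

lemma overwrite_single (f : Unit ↪ κ) (x : Bits κ) (v : Bits Unit) :
    overwrite f x v = Function.update x (f ()) (v ()) := by
  rw [overwrite_eq_iff]
  constructor
  · ext; simp
  · intro k hk
    have : k ≠ f () := fun h => hk ⟨(), h.symm⟩
    simp [this]

/-- The embedding of one wire. -/
def single (a : κ) : Unit ↪ κ := ⟨fun _ => a, fun _ _ _ => rfl⟩

lemma isGate_negate (a : κ) : IsGate (permOp (negate a)) := by
  refine isGate_permOp (single a) (by simp) (negate ()) _ fun x => ?_
  rw [overwrite_single]
  change negate a x = Function.update x a (negate () (x ∘ single a) ())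
  rw [negate_apply, negate_apply, Function.update_self]
  rfl

/-- The wires of one level: `none` for the majority bit, `R` for the test outcomes, and `R + 1` for
a counter with values `0, …, R`. -/
abbrev LevelWires (R : ℕ) : Type := Option (Fin R ⊕ Fin (R + 1))

/-- The basis state with majority bit `b`, outcomes `σ` and counter `w`. -/
def levelBits {R : ℕ} (b : Bool) (σ : Bits (Fin R)) (w : Bits (Fin (R + 1))) : Bits
    (LevelWires R) :=
  fun i => i.elim b (Sum.elim σ w)

/-- The majority of the bits `σ r`, a tie counting as `false`. -/
def majority {R : ℕ} (σ : Bits (Fin R)) : Bool := decide (R < 2 * Finset.card {r | σ r = true})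

/-- The one-hot encoding of a number. -/
def oneHot {N : ℕ} (j : Fin N) : Bits (Fin N) := fun i => decide (i = j)

/-- The wire of the test `r`, as control, and those of the counter. -/
def countWires {R : ℕ} (r : Fin R) : Option (Fin (R + 1)) ↪ LevelWires R :=
  ⟨fun o => o.elim (some (Sum.inl r)) fun i => some (Sum.inr i), by
    rintro (_ | i) (_ | j) h <;> simp_all⟩

/-- Increases the one-hot counter by `1`, as a cyclic shift of its wires, if the outcome `r` is
`true`. -/
def countStep {R : ℕ} (r : Fin R) : QOp (LevelWires R) :=
  place (countWires r) (ctrl (permOp (wirePerm (List.finRange (R + 1)).formPerm)))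

lemma hasCircuit_countStep {R : ℕ} (r : Fin R) : HasCircuit (countStep r) ((R + 1) * 7) := by
  have := hasCircuit_wirePerm_formPerm (List.finRange (R + 1))
  rw [List.length_finRange] at this
  exact this.ctrl.place _

lemma formPerm_finRange_apply {R : ℕ} (j : ℕ) :
    (List.finRange (R + 1)).formPerm (Fin.ofNat (R + 1) j) = Fin.ofNat (R + 1) (j + 1) := by
  have h := List.formPerm_apply_getElem (List.finRange (R + 1))
    (List.nodup_finRange _) (j % (R + 1))
    (by simpa using Nat.mod_lt _ (Nat.succ_pos R))
  simp only [List.getElem_finRange, List.length_finRange] at h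
  exact h.trans (Fin.ext (Nat.mod_add_mod _ _ _))

lemma countStep_app {R : ℕ} (r : Fin R) (b : Bool) (σ : Bits (Fin R)) (j : ℕ) :
    (countStep r).app (basisKet (levelBits b σ (oneHot (Fin.ofNat (R + 1) j)))) =
      basisKet (levelBits b σ (oneHot (Fin.ofNat (R + 1) (j + (σ r).toNat)))) := by
  rw [countStep]
  set f := countWires r
  cases hσ : σ r
  · have h0 : (levelBits b σ (oneHot (Fin.ofNat (R + 1) j)) ∘ f) none = false := hσ
    rw [place_app_basisKet f (ctrl_app_basisKet_of_false _ h0), overwrite_self]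
    rfl
  · have h1 : (permOp (wirePerm (List.finRange (R + 1)).formPerm)).app
        (basisKet ((levelBits b σ (oneHot (Fin.ofNat (R + 1) j)) ∘ f) ∘ some)) =
        basisKet (oneHot (Fin.ofNat (R + 1) (j + 1))) := by
      rw [permOp_app_basisKet, wirePerm_apply]
      congr 1
      ext i
      change decide ((List.finRange (R + 1)).formPerm.symm i = Fin.ofNat (R + 1) j) = decide (i = _)
      rw [← formPerm_finRange_apply]
      simp only [Equiv.symm_apply_eq]
    have h0 : (levelBits b σ (oneHot (Fin.ofNat (R + 1) j)) ∘ f) none = true := hσ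
    rw [place_app_basisKet f (ctrl_app_basisKet_of_true h0 h1)]
    congr 1
    rw [overwrite_eq_iff]
    constructor
    · ext (_ | i)
      · rw [overwrite_some_none]; rfl
      · exact (overwrite_apply Function.Embedding.some _
          (oneHot (Fin.ofNat (R + 1) (j + 1))) i).symm
    · rintro (_ | r' | i) hk
      · rfl
      · rfl
      · exact absurd ⟨some i, rfl⟩ hk

lemma list_countStep_app {R : ℕ} (l : List (Fin R)) (b : Bool) (σ : Bits (Fin R)) (j : ℕ) :
    QOp.app (l.map countStep).prod (basisKet (levelBits b σ (oneHot (Fin.ofNat (R + 1) j)))) =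
      basisKet (levelBits b σ (oneHot (Fin.ofNat (R + 1) (j + l.countP fun r => σ r)))) := by
  induction l with
  | nil => simp
  | cons r l ih =>
    rw [List.map_cons, List.prod_cons, mul_app, ih, countStep_app, List.countP_cons, add_assoc]
    cases σ r <;> simp

/-- Adds bit `i` of the counter to the majority bit. -/
def readStep {R : ℕ} (i : Fin (R + 1)) : QOp (LevelWires R) :=
  permOp (cnot (some (Sum.inr i)) none (by simp))

lemma list_readStep_app {R : ℕ} (l : List (Fin (R + 1))) (hl : l.Nodup) (σ : Bits (Fin R))
    (j : Fin (R + 1)) :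
    QOp.app (l.map readStep).prod (basisKet (levelBits false σ (oneHot j))) =
      basisKet (levelBits (decide (j ∈ l)) σ (oneHot j)) := by
  induction l with
  | nil => simp
  | cons i l ih =>
    rw [List.nodup_cons] at hl
    rw [List.map_cons, List.prod_cons, mul_app, ih hl.2, readStep, permOp_app_basisKet, cnot_apply]
    congr 1
    ext (_ | r | i')
    · have : i = j → j ∉ l := by rintro rfl; exact hl.1
      by_cases hij : i = j
      · subst hij
        simp [levelBits, oneHot, hl.1]
      · simp [levelBits, oneHot, hij, Ne.symm hij]
    · rfl
    · rfl

/-- The majority of `R` bits is computed by counting the bits that are `true` in a one-hot counter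
and reading off whether the count exceeds `R / 2`. The final content `w σ` of the counter is not
erased; it becomes part of the work register. -/
lemma exists_majority_circuit (R : ℕ) : ∃ (M : QOp (LevelWires R))
    (w : Bits (Fin R) → Bits (Fin (R + 1))),
    HasCircuit M (8 * (R + 1) ^ 2) ∧ ∀ σ, M.app (basisKet (levelBits false σ fun _ => false)) =
      basisKet (levelBits (majority σ) σ (w σ)) := by
  let cnt : Bits (Fin R) → ℕ := fun σ => (List.finRange R).countP fun r => σ r
  let l : List (Fin (R + 1)) := (List.finRange (R + 1)).filter fun i : Fin (R + 1) =>
    decide (R < 2 * (i : ℕ))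
  refine ⟨(l.map readStep).prod * ((List.finRange R).map countStep).prod *
    permOp (negate (some (Sum.inr 0))),
    fun σ => oneHot (Fin.ofNat (R + 1) (cnt σ)), ?_, fun σ => ?_⟩
  · have h1 : HasCircuit (l.map readStep).prod (R + 1) := by
      refine (HasCircuit.list_prod (s := 1) _ ?_).mono ?_
      · simp only [List.mem_map]
        rintro _ ⟨i, _, rfl⟩
        exact (isGate_cnot _ _ _).hasCircuit
      · simpa using List.length_filter_le (fun i : Fin (R + 1) => decide (R < 2 * (i : ℕ)))
          (List.finRange (R + 1))
    have h2 : HasCircuit ((List.finRange R).map countStep).prod (R * ((R + 1) * 7)) := by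
      refine (HasCircuit.list_prod (s := (R + 1) * 7) _ ?_).mono (by simp)
      simp only [List.mem_map]
      rintro _ ⟨i, _, rfl⟩
      exact hasCircuit_countStep i
    refine ((h1.mul h2).mul (isGate_negate _).hasCircuit).mono ?_
    nlinarith
  · have h0 : negate (some (Sum.inr 0)) (levelBits false σ fun _ => false) =
        levelBits false σ (oneHot (Fin.ofNat (R + 1) 0)) := by
      rw [negate_apply]
      ext (_ | r | i)
      · rfl
      · rfl
      · by_cases hi : i = 0
        · subst hi; simp [levelBits, oneHot]
        · simp [levelBits, oneHot, hi]
    rw [mul_app, mul_app, permOp_app_basisKet, h0, list_countStep_app, zero_add,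
      list_readStep_app _ ((List.nodup_finRange _).filter _)]
    have hcnt : cnt σ = Finset.card {r | σ r = true} := by
      rw [Finset.card_def, Finset.filter_val, ← Multiset.countP_eq_card_filter,
        show (Finset.univ : Finset (Fin R)).val = ↑(List.finRange R) from rfl, Multiset.coe_countP]
      simp [cnt]
    have hle : cnt σ < R + 1 := by
      have := List.countP_le_length (p := fun r => σ r) (l := List.finRange R)
      simp only [List.length_finRange] at this
      exact Nat.lt_succ_of_le this
    have : decide (Fin.ofNat (R + 1) (cnt σ) ∈ l) = majority σ := by
      simp only [l, List.mem_filter, List.mem_finRange, true_and, majority,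
        decide_eq_true_eq, Fin.val_ofNat,
        Nat.mod_eq_of_lt hle]
      rw [hcnt]
    rw [this]

end

/-! ### Repeated Hadamard tests with feedback -/

noncomputable section

variable {ι κ : Type} [Fintype ι] [DecidableEq ι] [Fintype κ] [DecidableEq κ]

/-- The sign `(-1) ^ b`. -/
def bitSign (b : Bool) : ℂ := if b then -1 else 1

/-- The Hadamard gate on a single qubit. -/
def hadamardMatrix : QOp Unit :=
  Matrix.of fun x y => (if x () then bitSign (y ()) else 1) / (Real.sqrt 2 : ℂ)

/-- The Hadamard gate on the wire `a`. -/
def hadamard (a : κ) : QOp κ := place (single a) hadamardMatrix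

lemma sqrt_two_mul_self : (Real.sqrt 2 : ℂ) * (Real.sqrt 2 : ℂ) = 2 := by
  rw [← Complex.ofReal_mul, Real.mul_self_sqrt (by norm_num)]
  norm_num

lemma sum_bits_unit (F : Bits Unit → ℂ) : ∑ v, F v = F (fun _ => false) + F fun _ => true := by
  rw [← (Equiv.funUnique Unit Bool).symm.sum_comp]
  simp [add_comm]
  rfl

lemma isGate_hadamard (a : κ) : IsGate (hadamard a) := by
  refine isGate_place (single a) (by simp) ?_
  rw [Matrix.mem_unitaryGroup_iff]
  have h2 : (Real.sqrt 2 : ℂ) ≠ 0 := by simp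
  ext x y
  rw [Matrix.mul_apply, sum_bits_unit]
  have hxy : x = y ↔ x () = y () := ⟨fun h => by rw [h], fun h => funext fun _ => h⟩
  simp only [Matrix.star_apply, Matrix.one_apply, hxy, hadamardMatrix, Matrix.of_apply, bitSign]
  have h3 : (Real.sqrt 2 : ℂ)⁻¹ * (Real.sqrt 2 : ℂ)⁻¹ = 1 / 2 := by
    rw [← mul_inv, sqrt_two_mul_self, one_div]
  cases x () <;> cases y () <;> simp [div_eq_mul_inv, h3] <;> norm_num

lemma hadamard_app (a : κ) (φ : QState κ) (x : Bits κ) : (hadamard a).app φ x =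
    (φ (Function.update x a false) + bitSign (x a) * φ (Function.update x a true)) /
        (Real.sqrt 2 : ℂ) := by
  rw [hadamard, place_app, sum_bits_unit, overwrite_single, overwrite_single]
  have h1 : (x ∘ single a) () = x a := rfl
  have h2 : single a () = a := rfl
  simp only [h1, h2, hadamardMatrix, Matrix.of_apply, bitSign]
  cases x a <;> simp <;> ring

/-- The Hadamard test, with the wire `a` as control, for an operation that acts as the phase
`D y`. -/
def hadamardTest (a : κ) (D : Bits κ → ℂ) : QOp κ :=
  hadamard a * (Matrix.diagonal fun y : Bits κ => if y a then D y else 1 : QOp κ) * hadamard a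

/-- The amplitude of the outcome `s` of a Hadamard test for the phase `z`. -/
def testAmplitude (z : ℂ) (s : Bool) : ℂ := (1 + bitSign s * z) / 2

lemma hadamardTest_app {a : κ} {D : Bits κ → ℂ} (hD : ∀ y b, D (Function.update y a b) = D y)
    {Φ : QState κ} (hΦ : ∀ y, y a = true → Φ y = 0) (y : Bits κ) :
    (hadamardTest a D).app Φ y = Φ (Function.update y a false) * testAmplitude (D y) (y a) := by
  have h1 : ∀ x : Bits κ, Φ (Function.update x a true) = 0 := fun x => hΦ _ (by simp)
  have h2 : (Real.sqrt 2 : ℂ) ≠ 0 := by simp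
  rw [hadamardTest, mul_app, mul_app]
  simp only [hadamard_app, diagonal_app, Function.update_idem, Function.update_self, h1,
    hD, testAmplitude]
  field_simp
  rw [pow_two, sqrt_two_mul_self]
  simp
  ring

/-- The bits `y` with the wires of the list reset to zero. -/
def clearBits (l : List κ) (y : Bits κ) : Bits κ := fun w => if w ∈ l then false else y w

/-- Hadamard tests for the same phase on several wires give independent outcomes. -/
lemma list_hadamardTest_app {l : List κ} (hl : l.Nodup) {D : Bits κ → ℂ}
    (hD : ∀ a ∈ l, ∀ y b, D (Function.update y a b) = D y)
    {Φ : QState κ} (hΦ : ∀ a ∈ l, ∀ y, y a = true → Φ y = 0) (y : Bits κ) :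
    QOp.app (l.map fun a => hadamardTest a D).prod Φ y =
      Φ (clearBits l y) * (l.map fun a => testAmplitude (D y) (y a)).prod := by
  induction l generalizing y with
  | nil =>
    have : clearBits [] y = y := by ext w; simp [clearBits]
    simp [this]
  | cons a l ih =>
    rw [List.nodup_cons] at hl
    simp only [List.mem_cons, forall_eq_or_imp] at hD hΦ
    rw [List.map_cons, List.prod_cons, mul_app, hadamardTest_app hD.1, ih hl.2 hD.2 hΦ.2]
    · have h1 : clearBits l (Function.update y a false) = clearBits (a :: l) y := by
        ext w
        by_cases hw : w = a
        · subst hw; simp [clearBits]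
        · simp [clearBits, hw]
      have h2 : (l.map fun b => testAmplitude (D (Function.update y a false))
          (Function.update y a false b)) =
          l.map fun b => testAmplitude (D y) (y b) := by
        refine List.map_congr_left fun b hb => ?_
        have : b ≠ a := by rintro rfl; exact hl.1 hb
        rw [hD.1, Function.update_of_ne this]
      rw [h1, h2, List.map_cons, List.prod_cons]
      ring
    · intro y hy
      rw [ih hl.2 hD.2 hΦ.2, hΦ.1 _ (by simpa [clearBits, hl.1] using hy), zero_mul]

/-- The wires of all levels. -/
abbrev EstWires (m R : ℕ) : Type := Fin m × LevelWires R

/-- The wires of the level `k`. -/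
def levelEmb {m R : ℕ} (k : Fin m) : LevelWires R ↪ EstWires m R :=
  ⟨fun o => (k, o), fun _ _ h => (Prod.mk.inj h).2⟩

variable {m R : ℕ}

/-- The outcomes of the tests of level `k`. -/
def testBits (k : Fin m) (y : Bits (EstWires m R)) : Bits (Fin R) :=
  fun r => y (k, some (Sum.inl r))

/-- The majority bits of all levels: the digits of the estimate. -/
def outBits (y : Bits (EstWires m R)) : Bits (Fin m) := fun k => y (k, none)

lemma overwrite_levelEmb (k : Fin m) (y : Bits (EstWires m R)) (v : Bits (LevelWires R))
    (j : Fin m) (o : LevelWires R) :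
    overwrite (levelEmb k) y v (j, o) = if j = k then v o else y (j, o) := by
  split_ifs with h
  · subst h
    exact overwrite_apply (levelEmb j) y v o
  · refine overwrite_of_notMem _ _ _ ?_
    rintro ⟨o', ho⟩
    exact h (Prod.mk.inj ho).1.symm

/-- At level `k` of `y`, the majority bit and the counter are those computed from the test outcomes,
where `w` gives the final content of the counter. -/
def Consistent (w : Bits (Fin R) → Bits (Fin (R + 1))) (k : Fin m)
    (y : Bits (EstWires m R)) : Prop :=
  y ∘ levelEmb k = levelBits (majority (testBits k y)) (testBits k y) (w (testBits k y))

open Classical in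
lemma place_majority_app {M : QOp (LevelWires R)} {w : Bits (Fin R) → Bits (Fin (R + 1))}
    (hM : ∀ σ, M.app (basisKet (levelBits false σ fun _ => false)) =
      basisKet (levelBits (majority σ) σ (w σ))) (k : Fin m) {Φ : QState (EstWires m R)}
    (hΦ : ∀ y, (∃ o, (∀ r, o ≠ some (Sum.inl r)) ∧ y (k, o) = true) → Φ y = 0)
      (y : Bits (EstWires m R)) :
    (place (levelEmb k) M).app Φ y = if Consistent w k y then
      Φ (overwrite (levelEmb k) y (levelBits false (testBits k y) fun _ => false)) else 0 := by
  have hM' : ∀ x σ, M x (levelBits false σ fun _ => false) =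
      if x = levelBits (majority σ) σ (w σ) then 1 else 0 := fun x σ => by
    rw [← app_basisKet M, hM, basisKet_apply]
  rw [place_app, Finset.sum_eq_single (levelBits false (testBits k y) fun _ => false)]
  · rw [hM']
    simp only [ite_mul, one_mul, zero_mul]
    exact if_congr Iff.rfl rfl rfl
  · intro v _ hv
    by_cases h0 : ∃ o, (∀ r, o ≠ some (Sum.inl r)) ∧ v o = true
    · obtain ⟨o, ho, hvo⟩ := h0
      rw [hΦ _ ⟨o, ho, by rw [overwrite_levelEmb, if_pos rfl, hvo]⟩, mul_zero]
    · push Not at h0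
      have hv2 : v = levelBits false (fun r => v (some (Sum.inl r))) fun _ => false := by
        ext (_ | r | i)
        · simpa [levelBits] using h0 none (by simp)
        · rfl
        · simpa [levelBits] using h0 (some (Sum.inr i)) (by simp)
      rw [hv2, hM', if_neg, zero_mul]
      intro h
      apply hv
      rw [hv2]
      congr 1
      ext r
      exact (congrFun h (some (Sum.inl r))).symm
  · simp

/-- The operation of level `k`: its Hadamard tests, for a phase `D` depending on the digits already
found, and the computation `M` of their majority. -/
def levelOp (M : QOp (LevelWires R)) (D : Bits (Fin m) → ℂ) (k : Fin m) : QOp (EstWires m R) :=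
  place (levelEmb k) M *
    ((List.finRange R).map fun r => hadamardTest (k, some (Sum.inl r)) fun y => D (outBits y)).prod

open Classical in
/-- The effect of one level, on a state in which its wires are all `0`. -/
lemma levelOp_app {M : QOp (LevelWires R)} {w : Bits (Fin R) → Bits (Fin (R + 1))}
    (hM : ∀ σ, M.app (basisKet (levelBits false σ fun _ => false)) =
      basisKet (levelBits (majority σ) σ (w σ))) (k : Fin m) {D : Bits (Fin m) → ℂ}
    (hD : ∀ (b : Bits (Fin m)) (c : Bool), D (Function.update b k c) = D b)
      {Φ : QState (EstWires m R)}
    (hΦ : ∀ y, (∃ o, y (k, o) = true) → Φ y = 0) (y : Bits (EstWires m R)) :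
    (levelOp M D k).app Φ y = if Consistent w k y then
      Φ (overwrite (levelEmb k) y fun _ => false) *
        ∏ r, testAmplitude (D (outBits y)) (y (k, some (Sum.inl r))) else 0 := by
  set l : List (EstWires m R) := (List.finRange R).map fun r => (k, some (Sum.inl r)) with hl
  have hnd : l.Nodup := (List.nodup_finRange R).map fun r s h => by simpa using h
  have hmem : ∀ a ∈ l, ∃ r : Fin R, a = (k, some (Sum.inl r)) := by
    intro a ha
    obtain ⟨r, -, rfl⟩ := List.mem_map.mp ha
    exact ⟨r, rfl⟩
  have hmem' : ∀ a, a ∈ l ↔ ∃ r : Fin R, a = (k, some (Sum.inl r)) := fun a =>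
    ⟨hmem a, by rintro ⟨r, rfl⟩; exact List.mem_map.mpr ⟨r, List.mem_finRange r, rfl⟩⟩
  have hD' : ∀ a ∈ l, ∀ (y : Bits (EstWires m R)) b,
      D (outBits (Function.update y a b)) = D (outBits y) := by
    intro a ha y b
    obtain ⟨r, rfl⟩ := hmem a ha
    congr 1
    ext i
    simp [outBits]
  have htests : ∀ y, QOp.app ((List.finRange R).map fun r => hadamardTest (k, some (Sum.inl r))
      fun y : Bits (EstWires m R) =>
      D (outBits y)).prod Φ y = Φ (clearBits l y) *
        ∏ r, testAmplitude (D (outBits y)) (y (k, some (Sum.inl r))) := by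
    intro y
    have := list_hadamardTest_app hnd (D := fun y => D (outBits y)) hD' (Φ := Φ)
        (fun a ha y hy => by
      obtain ⟨r, rfl⟩ := hmem a ha
      exact hΦ y ⟨_, hy⟩) y
    rw [hl, List.map_map, List.map_map] at this
    rw [← hl] at this
    rw [← List.prod_ofFn, List.ofFn_eq_map]
    exact this
  rw [levelOp, mul_app, place_majority_app hM]
  · congr 1
    rw [htests]
    have h1 : clearBits l (overwrite (levelEmb k) y
        (levelBits false (testBits k y) fun _ => false)) =
        overwrite (levelEmb k) y fun _ => false := by
      ext ⟨j, o⟩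
      simp only [clearBits, overwrite_levelEmb, hmem']
      by_cases hj : j = k
      · subst hj
        rcases o with _ | r | i <;> simp [levelBits]
      · simp [hj]
    have h2 : D (outBits (overwrite (levelEmb k) y
        (levelBits false (testBits k y) fun _ => false))) =
        D (outBits y) := by
      rw [← hD (outBits y) false]
      congr 1
      ext i
      by_cases hi : i = k
      · subst hi; simp [outBits, overwrite_levelEmb, levelBits]
      · simp [outBits, overwrite_levelEmb, hi]
    rw [h1, h2]
    congr 1
    refine Finset.prod_congr rfl fun r _ => ?_
    rw [overwrite_levelEmb, if_pos rfl]
    rfl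
  · rintro y ⟨o, ho, hy⟩
    rw [htests, hΦ _ ⟨o, ?_⟩, zero_mul]
    rw [clearBits, if_neg, hy]
    rw [hmem']
    rintro ⟨r, hr⟩
    exact ho r (Prod.mk.inj hr).2

open Classical in
/-- The state after the first `k` levels: the outcomes of the tests determine the majority bits and
the counters, and the amplitude is the product of the amplitudes of the tests. -/
def estState (w : Bits (Fin R) → Bits (Fin (R + 1))) (D : Fin m → Bits (Fin m) → ℂ) (k : ℕ) :
    QState (EstWires m R) :=
  WithLp.toLp 2 fun y =>
    if (∀ j : Fin m, (j : ℕ) < k → Consistent w j y) ∧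
        ∀ j : Fin m, k ≤ j → ∀ o, y (j, o) = false then
      ∏ j ∈ Finset.univ.filter fun j : Fin m => (j : ℕ) < k, ∏ r,
        testAmplitude (D j (outBits y)) (y (j, some (Sum.inl r)))
    else 0

open Classical in
lemma estState_apply (w : Bits (Fin R) → Bits (Fin (R + 1))) (D : Fin m → Bits (Fin m) → ℂ) (k : ℕ)
    (y : Bits (EstWires m R)) : estState w D k y =
      if (∀ j : Fin m, (j : ℕ) < k → Consistent w j y) ∧
          ∀ j : Fin m, k ≤ j → ∀ o, y (j, o) = false then
        ∏ j ∈ Finset.univ.filter fun j : Fin m => (j : ℕ) < k,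
          ∏ r, testAmplitude (D j (outBits y)) (y (j, some (Sum.inl r)))
      else 0 := rfl

lemma estState_zero (w : Bits (Fin R) → Bits (Fin (R + 1))) (D : Fin m → Bits (Fin m) → ℂ) :
    estState w D 0 = zeroKet _ := by
  ext y
  rw [zeroKet_apply]
  simp [estState, funext_iff]

/-- One level of the estimation. The phase of level `k` depends only on the lower digits (`hD`),
which this and later levels do not change, so that it may be written in terms of the final
digits. -/
lemma levelOp_app_estState {M : QOp (LevelWires R)} {w : Bits (Fin R) → Bits (Fin (R + 1))}
    (hM : ∀ σ, M.app (basisKet (levelBits false σ fun _ => false)) =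
      basisKet (levelBits (majority σ) σ (w σ))) {D : Fin m → Bits (Fin m) → ℂ}
    (hD : ∀ k b b', (∀ i < k, b i = b' i) → D k b = D k b') (k : Fin m) :
    (levelOp M (D k) k).app (estState w D k) = estState w D (k + 1) := by
  ext y
  rw [levelOp_app hM k]
  · have hcons : ∀ j ≠ k, Consistent w j (overwrite (levelEmb k) y fun _ => false) ↔
      Consistent w j y := by
      intro j hj
      have h1 : testBits j (overwrite (levelEmb k) y fun _ => false) = testBits j y := by
        ext r; simp [testBits, overwrite_levelEmb, hj]
      have h2 : (overwrite (levelEmb k) y fun _ => false) ∘ levelEmb j = y ∘ levelEmb j := by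
        ext o; exact (overwrite_levelEmb _ _ _ _ _).trans (if_neg hj)
      rw [Consistent, h1, h2, Consistent]
    rw [estState_apply, estState_apply]
    by_cases hk : Consistent w k y
    swap
    · rw [if_neg hk, if_neg]
      rintro ⟨h, -⟩
      exact hk (h k (Nat.lt_succ_self _))
    rw [if_pos hk]
    have hiff : ((∀ j : Fin m, (j : ℕ) < k → Consistent w j
        (overwrite (levelEmb k) y fun _ => false)) ∧
        ∀ j : Fin m, (k : ℕ) ≤ j → ∀ o, (overwrite (levelEmb k) y fun _ => false) (j, o) = false) ↔
        ((∀ j : Fin m, (j : ℕ) < k + 1 → Consistent w j y) ∧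
            ∀ j : Fin m, (k : ℕ) + 1 ≤ j → ∀ o, y (j, o) = false) := by
      refine and_congr ⟨fun h j hj => ?_, fun h j hj => ?_⟩ ⟨fun h j hj o => ?_, fun h j hj o => ?_⟩
      · rcases eq_or_ne j k with rfl | hne
        · exact hk
        · exact (hcons j hne).mp (h j (by have := Fin.val_ne_of_ne hne; omega))
      · exact (hcons j (by rintro rfl; omega)).mpr (h j (by omega))
      · have := h j (by omega) o
        rwa [overwrite_levelEmb, if_neg (by rintro rfl; omega)] at this
      · rw [overwrite_levelEmb]
        split_ifs with hjk
        · rfl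
        · exact h j (by have := Fin.val_ne_of_ne hjk; omega) o
    by_cases hv : (∀ j : Fin m, (j : ℕ) < k + 1 → Consistent w j y) ∧
        ∀ j : Fin m, (k : ℕ) + 1 ≤ j → ∀ o, y (j, o) = false
    · rw [if_pos hv, if_pos (hiff.mpr hv)]
      have hset : (Finset.univ.filter fun j : Fin m => (j : ℕ) < k + 1) =
          insert k (Finset.univ.filter fun j : Fin m => (j : ℕ) < k) := by
        ext j
        simp [Fin.ext_iff]
        omega
      rw [hset, Finset.prod_insert (by simp), mul_comm]
      congr 1
      refine Finset.prod_congr rfl fun j hj => Finset.prod_congr rfl fun r _ => ?_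
      have hjk : j ≠ k := by rintro rfl; simp at hj
      rw [overwrite_levelEmb, if_neg hjk]
      congr 1
      refine hD j _ _ fun i hi => ?_
      have hik : i ≠ k := by
        rintro rfl
        simp at hj
        omega
      simp [outBits, overwrite_levelEmb, hik]
    · rw [if_neg hv, if_neg (mt hiff.mp hv), zero_mul]
  · intro b c
    refine hD k _ _ fun i hi => ?_
    simp [hi.ne]
  · rintro y ⟨o, ho⟩
    rw [estState_apply, if_neg]
    rintro ⟨-, h⟩
    simp [h k le_rfl o] at ho

end

/-! ### The distribution of a single digit -/

noncomputable section

variable {m R : ℕ}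

/-- The probability that `b` is the majority of `R` independent bits of distribution `p`. -/
def majorityProb (R : ℕ) (p : Bool → ℝ) (b : Bool) : ℝ :=
  ∑ σ : Bits (Fin R) with majority σ = b, ∏ r, p (σ r)

lemma majorityProb_add (p : Bool → ℝ) (hp : p true + p false = 1) (b : Bool) :
    majorityProb R p b + majorityProb R p (!b) = 1 := by
  have h : ∑ σ : Bits (Fin R), ∏ r, p (σ r) = 1 := by
    have := Finset.prod_univ_sum (fun _ : Fin R => (Finset.univ : Finset Bool)) fun _ b => p b
    rw [Fintype.piFinset_univ] at this
    rw [← this]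
    simp [hp]
  rw [← h, ← Finset.sum_filter_add_sum_filter_not Finset.univ fun σ : Bits (Fin R) =>
    majority σ = b]
  unfold majorityProb
  congr 1
  refine Finset.sum_congr ?_ fun _ _ => rfl
  ext σ
  cases b <;> simp

lemma majorityProb_nonneg {p : Bool → ℝ} (h0 : ∀ b, 0 ≤ p b) (b : Bool) : 0 ≤ majorityProb R p b :=
  Finset.sum_nonneg fun _ _ => Finset.prod_nonneg fun _ _ => h0 _

lemma majorityProb_le_one {p : Bool → ℝ} (h0 : ∀ b, 0 ≤ p b)
    (hp : p true + p false = 1) (b : Bool) :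
    majorityProb R p b ≤ 1 := by
  linarith [majorityProb_add (R := R) p hp b, majorityProb_nonneg (R := R) h0 (!b)]

/-- A string of outcomes with at least as many wrong bits (probability `q`) as right ones (`P`) is
no likelier than if both probabilities were their geometric mean. -/
lemma pow_mul_pow_le_pow {q P t : ℝ} (hq : 0 ≤ q) (hP : 0 ≤ P) (hqt : q ≤ t)
    (ht : q * P = t ^ 2) {u v : ℕ}
    (huv : u ≤ v) : q ^ v * P ^ u ≤ t ^ (u + v) := by
  obtain ⟨d, rfl⟩ := Nat.exists_eq_add_of_le huv
  calc q ^ (u + d) * P ^ u = (q * P) ^ u * q ^ d := by rw [pow_add, mul_pow]; ring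
    _ ≤ (q * P) ^ u * t ^ d := by gcongr
    _ = t ^ (u + (u + d)) := by rw [ht, ← pow_mul, ← pow_add]; congr 1; ring

/-- Each of the at most `2 ^ R` strings with the wrong majority has probability at most
`(s / 2) ^ R`, where `s / 2` is the geometric mean of the probabilities of the two bits. -/
lemma one_sub_pow_le_majorityProb {p : Bool → ℝ} (h0 : ∀ b, 0 ≤ p b)
    (hp : p true + p false = 1) (b : Bool)
    {s : ℝ} (hs : p (!b) ≤ s / 2) (hsp : p (!b) * p b = (s / 2) ^ 2) :
    1 - s ^ R ≤ majorityProb R p b := by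
  have hwrong : majorityProb R p (!b) ≤ s ^ R := by
    have hterm : ∀ σ ∈ Finset.univ.filter fun σ : Bits (Fin R) => majority σ = !b,
        ∏ r, p (σ r) ≤ (s / 2) ^ R := by
      intro σ hσ
      have hσ' := (Finset.mem_filter.mp hσ).2
      have hcard : Finset.card {r | σ r = true} + Finset.card {r | ¬ σ r = true} = R := by
        rw [Finset.card_filter_add_card_filter_not]
        simp
      have hprod : ∏ r, p (σ r) =
          p true ^ Finset.card {r | σ r = true} * p false ^ Finset.card {r | ¬ σ r = true} := by
        rw [← Finset.prod_const, ← Finset.prod_const, ← Finset.prod_filter_mul_prod_filter_not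
          Finset.univ fun r => σ r = true]
        congr 1
        · exact Finset.prod_congr rfl fun r hr => by rw [(Finset.mem_filter.mp hr).2]
        · exact Finset.prod_congr rfl fun r hr => by
            rw [Bool.eq_false_iff.mpr (Finset.mem_filter.mp hr).2]
      rw [hprod]
      refine le_of_le_of_eq ?_ (congrArg ((s / 2) ^ ·) hcard)
      unfold majority at hσ'
      cases b
      · simp only [Bool.not_false, decide_eq_true_eq] at hσ' hs hsp
        rw [add_comm]
        exact pow_mul_pow_le_pow (h0 _) (h0 _) hs hsp (by omega)
      · simp only [Bool.not_true, decide_eq_false_iff_not] at hσ' hs hsp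
        rw [mul_comm]
        exact pow_mul_pow_le_pow (h0 _) (h0 _) hs hsp (by omega)
    have hs0 : 0 ≤ s / 2 := (h0 _).trans hs
    calc majorityProb R p (!b) ≤ ∑ σ : Bits (Fin R) with majority σ = !b, (s / 2) ^ R :=
      Finset.sum_le_sum hterm
      _ ≤ ∑ σ : Bits (Fin R), (s / 2) ^ R :=
        Finset.sum_le_sum_of_subset_of_nonneg (Finset.filter_subset _ _) fun _ _ _ => by positivity
      _ = s ^ R := by
        rw [Finset.sum_const, Finset.card_univ, nsmul_eq_mul, Fintype.card_fun]
        simp only [Fintype.card_bool, Fintype.card_fin]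
        push_cast
        rw [← mul_pow]
        congr 1
        ring
  linarith [majorityProb_add (R := R) p hp b]

/-- The union bound for independent events. -/
lemma one_sub_sum_le_prod {ι : Type*} (t : Finset ι) {Q s : ι → ℝ} (h0 : ∀ i ∈ t, 0 ≤ Q i)
    (h1 : ∀ i ∈ t, Q i ≤ 1) (h : ∀ i ∈ t, 1 - s i ≤ Q i) : 1 - ∑ i ∈ t, s i ≤ ∏ i ∈ t, Q i := by
  classical
  induction t using Finset.induction_on with
  | empty => simp
  | insert a t ha ih =>
    rw [Finset.sum_insert ha, Finset.prod_insert ha]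
    simp only [Finset.mem_insert, forall_eq_or_imp] at h0 h1 h
    have h2 := ih h0.2 h1.2 h.2
    have h3 : ∏ i ∈ t, Q i ≤ 1 := Finset.prod_le_one h0.2 h1.2
    nlinarith [h.1, h1.1]

lemma norm_sq_testAmplitude (φ : ℝ) (s : Bool) :
    ‖testAmplitude (Complex.exp (-(Complex.I * φ))) s‖ ^ 2 =
      (1 + (if s then -1 else 1) * Real.cos φ) / 2 := by
  have h : Complex.exp (-(Complex.I * φ)) = ⟨Real.cos φ, -Real.sin φ⟩ := by
    have : -(Complex.I * φ) = ((-φ : ℝ) : ℂ) * Complex.I := by push_cast; ring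
    rw [this, Complex.exp_mul_I, ← Complex.ofReal_cos, ← Complex.ofReal_sin,
      Real.cos_neg, Real.sin_neg]
    apply Complex.ext <;> simp [Complex.cos_ofReal_re, Complex.sin_ofReal_re]
  rw [← Complex.normSq_eq_norm_sq, testAmplitude, h, bitSign, Complex.normSq_div,
    Complex.normSq_apply]
  have h2 := Real.sin_sq_add_cos_sq φ
  have h4 : Complex.normSq 2 = 4 := by rw [Complex.normSq_apply]; norm_num
  rw [h4]
  cases s <;> simp <;> field_simp <;> nlinarith

/-- The probability of reading the digits `b`: the levels are independent once the digits are
fixed. -/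
lemma sum_estState_norm_sq (w : Bits (Fin R) → Bits (Fin (R + 1))) (D : Fin m → Bits (Fin m) → ℂ)
    (b : Bits (Fin m)) :
    ∑ y : Bits (EstWires m R) with outBits y = b, ‖estState w D m y‖ ^ 2 =
      ∏ j, majorityProb R (fun s => ‖testAmplitude (D j b) s‖ ^ 2) (b j) := by
  classical
  unfold majorityProb
  rw [Finset.prod_univ_sum]
  have hvac : ∀ y : Bits (EstWires m R), ∀ j : Fin m, m ≤ j → ∀ o, y (j, o) = false := fun y j hj =>
    absurd j.2 (by omega)
  have hall : ∀ y : Bits (EstWires m R), ((∀ j : Fin m, (j : ℕ) < m → Consistent w j y) ∧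
      ∀ j : Fin m, m ≤ j → ∀ o, y (j, o) = false) ↔ ∀ j : Fin m, Consistent w j y := fun y =>
    ⟨fun h j => h.1 j j.2, fun h => ⟨fun j _ => h j, hvac y⟩⟩
  have hset : (Finset.univ.filter fun j : Fin m => (j : ℕ) < m) = Finset.univ := by
    ext j; simp
  simp only [estState_apply, hall, hset]
  have hL : ∀ y : Bits (EstWires m R), ‖(if ∀ j : Fin m, Consistent w j y then
      ∏ j, ∏ r, testAmplitude (D j (outBits y)) (y (j, some (Sum.inl r))) else 0 : ℂ)‖ ^ 2 =
      if ∀ j : Fin m, Consistent w j y then ∏ j, ∏ r,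
          ‖testAmplitude (D j (outBits y)) (y (j, some (Sum.inl r)))‖ ^ 2 else 0 := by
    intro y
    split_ifs
    · simp only [norm_prod, Finset.prod_pow]
    · simp
  simp only [hL]
  rw [← Finset.sum_filter, Finset.filter_filter]
  refine Finset.sum_nbij' (fun y j => testBits j y)
    (fun S w' => levelBits (majority (S w'.1)) (S w'.1) (w (S w'.1)) w'.2) ?_ ?_ ?_ ?_ ?_
  · intro y hy
    obtain ⟨-, hy, hc⟩ := Finset.mem_filter.mp hy
    rw [Fintype.mem_piFinset]
    intro j
    rw [Finset.mem_filter]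
    refine ⟨Finset.mem_univ _, ?_⟩
    rw [← hy]
    exact (congrFun (hc j) none).symm
  · intro S hS
    rw [Fintype.mem_piFinset] at hS
    rw [Finset.mem_filter]
    refine ⟨Finset.mem_univ _, ?_, fun j => ?_⟩
    · ext j
      exact (Finset.mem_filter.mp (hS j)).2
    · rfl
  · intro y hy
    obtain ⟨-, -, hc⟩ := Finset.mem_filter.mp hy
    ext ⟨j, o⟩
    exact (congrFun (hc j) o).symm
  · intro S _
    rfl
  · intro y hy
    obtain ⟨-, hy, -⟩ := Finset.mem_filter.mp hy
    rw [hy]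
    rfl

/-- The number with the binary digits `b i`, `i < k`. -/
def lowBits (b : Bits (Fin m)) (k : ℕ) : ℝ :=
  ∑ i : Fin m, if (i : ℕ) < k ∧ b i then (2 : ℝ) ^ (i : ℕ) else 0

/-- The `m` lowest binary digits of `N`. -/
def natBits (m N : ℕ) : Bits (Fin m) := fun i => N.testBit i

lemma mod_two_pow_succ_eq (N k : ℕ) : N % 2 ^ (k + 1) =
    N % 2 ^ k + 2 ^ k * (N.testBit k).toNat := by
  rw [Nat.mod_pow_succ, Nat.testBit_eq_decide_div_mod_eq]
  congr 2
  rcases Nat.mod_two_eq_zero_or_one (N / 2 ^ k) with h | h <;> simp [h]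

lemma lowBits_natBits (N : ℕ) {k : ℕ} (hk : k ≤ m) : lowBits (natBits m N) k = (N % 2 ^ k : ℕ) := by
  have h : lowBits (natBits m N) k = ∑ i ∈ Finset.range k,
      if N.testBit i then (2 : ℝ) ^ i else 0 := by
    unfold lowBits natBits
    rw [Fin.sum_univ_eq_sum_range fun i => if i < k ∧ N.testBit i then (2 : ℝ) ^ i else 0]
    simp only [ite_and]
    rw [← Finset.sum_filter]
    refine Finset.sum_congr ?_ fun _ _ => rfl
    ext i
    simp
    omega
  rw [h]
  clear h hk
  induction k with
  | zero => simp [Nat.mod_one]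
  | succ k ih =>
    rw [Finset.sum_range_succ, ih, mod_two_pow_succ_eq]
    cases N.testBit k <;> simp

/-- The phase tested at level `k`, for the number `x` to be estimated and the digits `b`. -/
def levelPhase (x : ℝ) (k : Fin m) (b : Bits (Fin m)) : ℂ :=
  Complex.exp (-(Complex.I * ((Real.pi * (x - lowBits b k) / 2 ^ (k : ℕ) : ℝ) : ℂ)))

lemma levelPhase_congr (x : ℝ) (k : Fin m) (b b' : Bits (Fin m)) (h : ∀ i < k, b i = b' i) :
    levelPhase x k b = levelPhase x k b' := by
  have : lowBits b k = lowBits b' k := by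
    refine Finset.sum_congr rfl fun i _ => ?_
    by_cases hi : (i : ℕ) < k
    · rw [h i hi]
    · simp [hi]
  rw [levelPhase, levelPhase, this]

/-- Once the lower digits of `N` are found, the digit `k` of `N` is the more likely outcome at level
`k` provided that `x` is close to `N`: the higher digits of `N` change the phase by multiples of
`2 π`, the digit `k` by `π` or `0`. -/
lemma norm_sq_testAmplitude_levelPhase (x : ℝ) (k : Fin m) (N : ℕ) (s : Bool) :
    ‖testAmplitude (levelPhase x k (natBits m N)) s‖ ^ 2 =
      (1 + (if s = natBits m N k then 1 else -1) *
          Real.cos (Real.pi * (x - N) / 2 ^ (k : ℕ))) / 2 := by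
  rw [levelPhase, norm_sq_testAmplitude, lowBits_natBits N k.2.le]
  have h1 : (N : ℝ) = (N % 2 ^ (k : ℕ) : ℕ) + 2 ^ (k : ℕ) * ((N.testBit k).toNat : ℝ) +
      2 ^ ((k : ℕ) + 1) * (N / 2 ^ ((k : ℕ) + 1) : ℕ) := by
    have := Nat.mod_add_div N (2 ^ ((k : ℕ) + 1))
    rw [mod_two_pow_succ_eq] at this
    exact_mod_cast this.symm
  have h2 : Real.pi * (x - (N % 2 ^ (k : ℕ) : ℕ)) / 2 ^ (k : ℕ) = Real.pi * (x - N) / 2 ^ (k : ℕ) +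
      Real.pi * ((N.testBit k).toNat : ℝ) + (N / 2 ^ ((k : ℕ) + 1) : ℕ) * (2 * Real.pi) := by
    have : x - (N % 2 ^ (k : ℕ) : ℕ) = (x - N) + 2 ^ (k : ℕ) * ((N.testBit k).toNat : ℝ) +
      2 ^ ((k : ℕ) + 1) * (N / 2 ^ ((k : ℕ) + 1) : ℕ) := by linarith
    rw [this, pow_succ]
    field_simp
  rw [h2, Real.cos_add_nat_mul_two_pi]
  unfold natBits
  cases N.testBit k <;> cases s <;> simp [Real.cos_add_pi]

lemma one_sub_sin_pow_le_majorityProb (x : ℝ) (k : Fin m) (N : ℕ)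
    (h : |Real.pi * (x - N) / 2 ^ (k : ℕ)| ≤ Real.pi / 2) :
    1 - |Real.sin (Real.pi * (x - N) / 2 ^ (k : ℕ))| ^ R ≤
      majorityProb R (fun s => ‖testAmplitude (levelPhase x k (natBits m N)) s‖ ^ 2)
          (natBits m N k) := by
  set θ := Real.pi * (x - N) / 2 ^ (k : ℕ) with hθ
  have hc : 0 ≤ Real.cos θ := Real.cos_nonneg_of_mem_Icc (by rwa [Set.mem_Icc, ← abs_le])
  have hc1 := Real.cos_le_one θ
  have h2 := Real.sin_sq_add_cos_sq θ
  have habs := sq_abs (Real.sin θ)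
  refine one_sub_pow_le_majorityProb (fun _ => by positivity) ?_ _ ?_ ?_
  · simp only [norm_sq_testAmplitude_levelPhase, ← hθ]
    cases natBits m N k <;> simp <;> ring
  · simp only [norm_sq_testAmplitude_levelPhase, ← hθ]
    have : (1 - Real.cos θ) ≤ |Real.sin θ| := abs_le_of_sq_le_sq' (by nlinarith) (abs_nonneg _) |>.2
    simp
    linarith
  · simp only [norm_sq_testAmplitude_levelPhase, ← hθ]
    simp
    nlinarith

lemma majorityProb_levelPhase_nonneg (x : ℝ) (k : Fin m) (b : Bits (Fin m)) (c : Bool) :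
    0 ≤ majorityProb R (fun s => ‖testAmplitude (levelPhase x k b) s‖ ^ 2) c :=
  majorityProb_nonneg (fun _ => by positivity) c

lemma norm_sq_testAmplitude_levelPhase_add (x : ℝ) (k : Fin m) (b : Bits (Fin m)) :
    ‖testAmplitude (levelPhase x k b) true‖ ^ 2 +
      ‖testAmplitude (levelPhase x k b) false‖ ^ 2 = 1 := by
  rw [levelPhase, norm_sq_testAmplitude, norm_sq_testAmplitude]
  simp
  ring

lemma majorityProb_levelPhase_le_one (x : ℝ) (k : Fin m) (b : Bits (Fin m)) (c : Bool) :
    majorityProb R (fun s => ‖testAmplitude (levelPhase x k b) s‖ ^ 2) c ≤ 1 :=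
  majorityProb_le_one (fun _ => by positivity) (norm_sq_testAmplitude_levelPhase_add x k b) c

/-- The sum over all levels of the probabilities of an error. The cubes add up to at most `9 / 10`:
the first is at most `(√3 / 2) ^ 3`, and the others decrease geometrically, as `|sin v| ≤ |v|`. -/
lemma sum_sin_pow_le {u : ℝ} (hu : |u| ≤ Real.pi / 3) (N : ℕ) {n : ℕ} (hn : 1 ≤ n) :
    ∑ k ∈ Finset.range N, |Real.sin (u / 2 ^ k)| ^ (3 * n) ≤ Real.exp (-(n : ℝ) / 18) := by
  have hpi := Real.pi_lt_d2
  have hpi0 := Real.pi_pos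
  have h0 : |Real.sin u| ^ 3 ≤ 13 / 20 := by
    have h1 : |Real.sin u| ≤ √3 / 2 := by
      rw [← Real.sin_pi_div_three, abs_le]
      rw [abs_le] at hu
      refine ⟨?_, Real.sin_le_sin_of_le_of_le_pi_div_two (by linarith) (by linarith) hu.2⟩
      rw [← Real.sin_neg]
      exact Real.sin_le_sin_of_le_of_le_pi_div_two (by linarith) (by linarith) hu.1
    have h3 : √3 ≤ 1.7321 := by
      rw [Real.sqrt_le_left (by norm_num)]
      norm_num
    calc |Real.sin u| ^ 3 ≤ (1.7321 / 2) ^ 3 := by gcongr; linarith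
      _ ≤ 13 / 20 := by norm_num
  have hk : ∀ k, |Real.sin (u / 2 ^ k)| ^ 3 ≤ 6 / 5 * (1 / 8) ^ k := by
    intro k
    have h1 : |Real.sin (u / 2 ^ k)| ≤ (Real.pi / 3) / 2 ^ k := by
      refine (Real.abs_sin_le_abs).trans ?_
      rw [abs_div, abs_of_pos (show (0 : ℝ) < 2 ^ k by positivity)]
      gcongr
    calc |Real.sin (u / 2 ^ k)| ^ 3 ≤ ((Real.pi / 3) / 2 ^ k) ^ 3 := by gcongr
      _ = (Real.pi / 3) ^ 3 * (1 / 8) ^ k := by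
        rw [div_pow, ← pow_mul, mul_comm k 3, pow_mul, one_div, inv_pow]
        norm_num
        rfl
      _ ≤ 6 / 5 * (1 / 8) ^ k := by
        gcongr
        calc (Real.pi / 3) ^ 3 ≤ (3.15 / 3) ^ 3 := by gcongr
          _ ≤ 6 / 5 := by norm_num
  have hsum : ∑ k ∈ Finset.range N, |Real.sin (u / 2 ^ k)| ^ 3 ≤ 9 / 10 := by
    have hgeo : ∀ M : ℕ, ∑ k ∈ Finset.range M, (6 / 5 : ℝ) * (1 / 8) ^ (k + 1) ≤ 1 / 4 := by
      intro M
      have : ∑ k ∈ Finset.range M, (6 / 5 : ℝ) * (1 / 8) ^ (k + 1) =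
          6 / 35 * (1 - (1 / 8) ^ M) := by
        induction M with
        | zero => simp
        | succ M ih => rw [Finset.sum_range_succ, ih, pow_succ]; ring
      rw [this]
      have : (0 : ℝ) ≤ (1 / 8) ^ M := by positivity
      linarith
    cases N with
    | zero => norm_num
    | succ M =>
      rw [Finset.sum_range_succ']
      have := (Finset.sum_le_sum fun k _ => hk (k + 1)).trans (hgeo M)
      simp only [pow_zero, div_one]
      linarith
  calc ∑ k ∈ Finset.range N, |Real.sin (u / 2 ^ k)| ^ (3 * n)
      = ∑ k ∈ Finset.range N, (|Real.sin (u / 2 ^ k)| ^ 3) ^ n := by simp only [pow_mul]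
    _ ≤ (∑ k ∈ Finset.range N, |Real.sin (u / 2 ^ k)| ^ 3) ^ n := by
      obtain ⟨l, rfl⟩ := Nat.exists_eq_add_of_le' hn
      simp only [pow_succ _ l]
      rw [Finset.mul_sum]
      refine Finset.sum_le_sum fun k hk => ?_
      gcongr
      exact Finset.single_le_sum (f := fun k => |Real.sin (u / 2 ^ k)| ^ 3)
        (fun _ _ => by positivity) hk
    _ ≤ (9 / 10) ^ n := by gcongr
    _ ≤ Real.exp (-1 / 18) ^ n := by
      gcongr
      have := Real.add_one_le_exp (-1 / 18 : ℝ)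
      linarith
    _ = Real.exp (-(n : ℝ) / 18) := by
      rw [← Real.exp_nat_mul]
      congr 1
      ring

end

/-! ### The distribution of the estimate -/

noncomputable section

variable {m R : ℕ}

/-- The probability that the estimation of `x` gives the digits `b`. -/
def outcomeProb (m R : ℕ) (x : ℝ) (b : Bits (Fin m)) : ℝ :=
  ∏ j, majorityProb R (fun s => ‖testAmplitude (levelPhase x j b) s‖ ^ 2) (b j)

lemma outcomeProb_nonneg (x : ℝ) (b : Bits (Fin m)) : 0 ≤ outcomeProb m R x b :=
  Finset.prod_nonneg fun _ _ => majorityProb_levelPhase_nonneg _ _ _ _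

lemma outcomeValue_natBits {p N : ℕ} (hN : N < 2 ^ (p + 2)) :
    outcomeValue (natBits (p + 2) N) = N / 2 ^ p - 2 := by
  have h := lowBits_natBits (m := p + 2) N le_rfl
  rw [Nat.mod_eq_of_lt hN] at h
  rw [outcomeValue, ← h, lowBits]
  congr 2
  refine Finset.sum_congr rfl fun i _ => ?_
  simp

/-- An integer within `1 / 3` of `x` is found with high probability. -/
lemma one_sub_exp_le_outcomeProb {n N : ℕ} (hn : 1 ≤ n) {x : ℝ} (h : |x - N| ≤ 1 / 3) :
    1 - Real.exp (-(n : ℝ) / 18) ≤ outcomeProb m (3 * n) x (natBits m N) := by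
  have hpi0 := Real.pi_pos
  have hu : |Real.pi * (x - N)| ≤ Real.pi / 3 := by
    rw [abs_mul, abs_of_pos hpi0]
    nlinarith
  have h1 := one_sub_sum_le_prod Finset.univ
    (s := fun j : Fin m => |Real.sin (Real.pi * (x - N) / 2 ^ (j : ℕ))| ^ (3 * n))
    (fun j _ => majorityProb_levelPhase_nonneg (R := 3 * n) x j (natBits m N) (natBits m N j))
    (fun j _ => majorityProb_levelPhase_le_one (R := 3 * n) x j (natBits m N) (natBits m N j))
    (fun j _ => one_sub_sin_pow_le_majorityProb x j N ?_)
  · rw [Fin.sum_univ_eq_sum_range fun j => |Real.sin (Real.pi * (x - N) / 2 ^ j)| ^ (3 * n)] at h1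
    exact le_trans (by linarith [sum_sin_pow_le hu m hn]) h1
  · rw [abs_div, abs_of_pos (show (0 : ℝ) < 2 ^ (j : ℕ) by positivity)]
    refine (div_le_self (abs_nonneg _) (one_le_pow₀ one_le_two)).trans ?_
    linarith

/-- An integer within `2 / 3` of `x` is found with high probability once its lowest digit is: from
the next level on, the angles are at most `π / 3`. -/
lemma le_outcomeProb_of_le_two_thirds {n N : ℕ} (hn : 1 ≤ n) {x : ℝ} (h : |x - N| ≤ 2 / 3) :
    majorityProb (3 * n) (fun s => ‖testAmplitude
      (levelPhase x (0 : Fin (m + 1)) (natBits (m + 1) N)) s‖ ^ 2)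
      (natBits (m + 1) N 0) * (1 - Real.exp (-(n : ℝ) / 18)) ≤
          outcomeProb (m + 1) (3 * n) x (natBits (m + 1) N) := by
  have hpi0 := Real.pi_pos
  have hu : |Real.pi * (x - N) / 2| ≤ Real.pi / 3 := by
    rw [abs_div, abs_mul, abs_of_pos hpi0, abs_two]
    nlinarith
  have hdiv : ∀ j : ℕ, Real.pi * (x - N) / 2 ^ (j + 1) =
      Real.pi * (x - N) / 2 / 2 ^ j := fun j => by
    rw [pow_succ]
    field_simp
  rw [outcomeProb, Fin.prod_univ_succ]
  refine mul_le_mul_of_nonneg_left ?_ (majorityProb_levelPhase_nonneg _ _ _ _)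
  have h1 := one_sub_sum_le_prod Finset.univ
    (s := fun j : Fin m => |Real.sin (Real.pi * (x - N) / 2 / 2 ^ (j : ℕ))| ^ (3 * n))
    (fun j _ => majorityProb_levelPhase_nonneg (R := 3 * n) x j.succ (natBits (m + 1) N)
      (natBits (m + 1) N j.succ))
    (fun j _ => majorityProb_levelPhase_le_one (R := 3 * n) x j.succ (natBits (m + 1) N)
      (natBits (m + 1) N j.succ))
    (fun j _ => ?_)
  · rw [Fin.sum_univ_eq_sum_range fun j =>
      |Real.sin (Real.pi * (x - N) / 2 / 2 ^ j)| ^ (3 * n)] at h1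
    exact le_trans (by linarith [sum_sin_pow_le hu m hn]) h1
  · rw [← hdiv, ← Fin.val_succ]
    refine one_sub_sin_pow_le_majorityProb x j.succ N ?_
    rw [Fin.val_succ, hdiv, abs_div, abs_of_pos (show (0 : ℝ) < 2 ^ (j : ℕ) by positivity)]
    refine (div_le_self (abs_nonneg _) (one_le_pow₀ one_le_two)).trans ?_
    linarith

/-- If no integer is within `1 / 3` of `x = (E + 2) 2 ^ p`, then the two neighbours `N` and `N + 1`
of `x` are both good outcomes. Their lowest digits differ, so that the probabilities of finding
these digits at level `0` add up to `1`. -/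
lemma one_sub_exp_le_sum_outcomeProb {n : ℕ} (hn : 1 ≤ n) (p : ℕ) {E : ℝ} (hE : |E| ≤ 1) {δ : ℝ}
    (hδ : 2 / 3 / 2 ^ p ≤ δ) :
    1 - Real.exp (-(n : ℝ) / 18) ≤ ∑ b : Bits (Fin (p + 2)) with |E - outcomeValue b| ≤ δ,
      outcomeProb (p + 2) (3 * n) ((E + 2) * 2 ^ p) b := by
  obtain ⟨hE1, hE2⟩ := abs_le.mp hE
  set x := (E + 2) * 2 ^ p with hx
  have h2p : (1 : ℝ) ≤ 2 ^ p := one_le_pow₀ one_le_two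
  have hx0 : 1 ≤ x := by nlinarith
  have hx3 : x ≤ 3 * 2 ^ p := by nlinarith
  have hgood : ∀ N : ℕ, |x - N| ≤ 2 / 3 → (N : ℝ) ≤ 3 * 2 ^ p →
      |E - outcomeValue (natBits (p + 2) N)| ≤ δ := by
    intro N hN hN3
    have hlt : N < 2 ^ (p + 2) := by
      have : (N : ℝ) < 2 ^ (p + 2) := by rw [pow_add]; linarith
      exact_mod_cast this
    have : E - (N / 2 ^ p - 2) = (x - N) / 2 ^ p := by
      rw [hx]
      field_simp
      ring
    rw [outcomeValue_natBits hlt, this, abs_div, abs_of_pos (show (0 : ℝ) < 2 ^ p by positivity)]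
    refine le_trans ?_ hδ
    gcongr
  have hone : ∀ N : ℕ, |x - N| ≤ 1 / 3 → (N : ℝ) ≤ 3 * 2 ^ p →
      1 - Real.exp (-(n : ℝ) / 18) ≤ ∑ b : Bits (Fin (p + 2)) with |E - outcomeValue b| ≤ δ,
      outcomeProb (p + 2) (3 * n) x b := by
    intro N hN hN3
    refine (one_sub_exp_le_outcomeProb (m := p + 2) hn hN).trans ?_
    exact Finset.single_le_sum (f := fun b => outcomeProb (p + 2) (3 * n) x b)
      (fun b _ => outcomeProb_nonneg x b)
      (Finset.mem_filter.mpr ⟨Finset.mem_univ _, hgood N (hN.trans (by norm_num)) hN3⟩)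
  set N := ⌊x⌋₊ with hN
  have hfl : (N : ℝ) ≤ x := Nat.floor_le (by linarith)
  have hfl' : x < N + 1 := Nat.lt_floor_add_one x
  have hup : x ≠ N → ((N + 1 : ℕ) : ℝ) ≤ 3 * 2 ^ p := by
    intro hne
    have h1 : (N : ℝ) < (3 * 2 ^ p : ℕ) := by
      push_cast
      exact (lt_of_le_of_ne hfl hne.symm).trans_le hx3
    have h2 : N + 1 ≤ 3 * 2 ^ p := by exact_mod_cast h1
    exact_mod_cast h2
  by_cases hA : x - N ≤ 1 / 3
  · exact hone N (by rw [abs_of_nonneg (by linarith)]; exact hA) (hfl.trans hx3)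
  by_cases hB : 2 / 3 ≤ x - N
  · refine hone (N + 1) ?_ (hup fun h => by linarith)
    push_cast
    rw [abs_of_nonpos (by linarith)]
    linarith
  push Not at hA hB
  have h1 : |x - N| ≤ 2 / 3 := by rw [abs_of_nonneg (by linarith)]; exact hB.le
  have h2 : |x - (N + 1 : ℕ)| ≤ 2 / 3 := by
    push_cast
    rw [abs_of_nonpos (by linarith)]
    linarith
  have hbit : natBits (p + 2) (N + 1) 0 = !natBits (p + 2) N 0 := by
    simp only [natBits, Fin.val_zero, Nat.testBit_zero]
    rcases Nat.mod_two_eq_zero_or_one N with h | h <;> simp [Nat.add_mod, h]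
  have hne : natBits (p + 2) N ≠ natBits (p + 2) (N + 1) := fun h => by
    rw [← h] at hbit
    simp at hbit
  have hphase : levelPhase x (0 : Fin (p + 2)) (natBits (p + 2) (N + 1)) =
      levelPhase x 0 (natBits (p + 2) N) :=
    levelPhase_congr x 0 _ _ fun i hi => absurd hi (Fin.not_lt_zero i)
  have h3 := le_outcomeProb_of_le_two_thirds (m := p + 1) hn h1
  have h4 := le_outcomeProb_of_le_two_thirds (m := p + 1) hn h2
  have h5 := majorityProb_add (R := 3 * n) (fun s =>
    ‖testAmplitude (levelPhase x (0 : Fin (p + 2)) (natBits (p + 2) N)) s‖ ^ 2)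
    (norm_sq_testAmplitude_levelPhase_add x (0 : Fin (p + 2)) (natBits (p + 2) N))
    (natBits (p + 2) N 0)
  rw [hphase, hbit] at h4
  calc 1 - Real.exp (-(n : ℝ) / 18)
      ≤ outcomeProb (p + 2) (3 * n) x (natBits (p + 2) N) +
          outcomeProb (p + 2) (3 * n) x (natBits (p + 2) (N + 1)) := by
        refine le_trans (le_of_eq ?_) (add_le_add h3 h4)
        rw [← add_mul, h5, one_mul]
    _ = ∑ b ∈ {natBits (p + 2) N, natBits (p + 2) (N + 1)}, outcomeProb (p + 2) (3 * n) x b :=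
        (Finset.sum_pair hne).symm
    _ ≤ _ := by
        refine Finset.sum_le_sum_of_subset_of_nonneg ?_ fun b _ _ => outcomeProb_nonneg x b
        intro b hb
        rw [Finset.mem_filter]
        refine ⟨Finset.mem_univ _, ?_⟩
        rcases Finset.mem_insert.mp hb with rfl | hb
        · exact hgood N h1 (hfl.trans hx3)
        · rw [Finset.mem_singleton.mp hb]
          exact hgood (N + 1) h2 (hup fun h => by linarith)

end

/-! ### Simulation of the estimation -/

noncomputable section

variable {ι κ : Type} [Fintype ι] [DecidableEq ι] [Fintype κ] [DecidableEq κ]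

lemma list_diagonal_prod {α : Type*} (l : List α) (d : α → Bits κ → ℂ) :
    (l.map fun a => (Matrix.diagonal (d a) : QOp κ)).prod = Matrix.diagonal fun y =>
        (l.map fun a => d a y).prod := by
  induction l with
  | nil => simp
  | cons a l ih => rw [List.map_cons, List.prod_cons, ih, Matrix.diagonal_mul_diagonal]; simp

/-- The evolution time in a test of level `k`. -/
def levelTime (p k : ℕ) : ℝ := Real.pi * 2 ^ p / 2 ^ k

/-- The phase of a level, as the product of a phase from the evolution, a constant one from the
offset `2` of the output register, and one for each lower digit. -/
lemma levelPhase_eq {m : ℕ} (p : ℕ) (E : ℝ) (k : Fin m) (b : Bits (Fin m)) :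
    levelPhase ((E + 2) * 2 ^ p) k b = Complex.exp (-(Complex.I * levelTime p k * E)) *
      (Complex.exp (((-(2 * levelTime p k) : ℝ) : ℂ) * Complex.I) *
        ((List.finRange m).map fun i : Fin m => if (i : ℕ) < k ∧ b i then
          Complex.exp (((Real.pi * 2 ^ (i : ℕ) / 2 ^ (k : ℕ) : ℝ) : ℂ) *
              Complex.I) else 1).prod) := by
  have h1 : ((List.finRange m).map fun i : Fin m => if (i : ℕ) < k ∧ b i then
      Complex.exp (((Real.pi * 2 ^ (i : ℕ) / 2 ^ (k : ℕ) : ℝ) : ℂ) * Complex.I) else 1).prod =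
      Complex.exp (((Real.pi * lowBits b k / 2 ^ (k : ℕ) : ℝ) : ℂ) * Complex.I) := by
    rw [← List.ofFn_eq_map, List.prod_ofFn]
    have : ∀ i : Fin m, (if (i : ℕ) < k ∧ b i then
        Complex.exp (((Real.pi * 2 ^ (i : ℕ) / 2 ^ (k : ℕ) : ℝ) : ℂ) * Complex.I) else 1) =
        Complex.exp (((Real.pi / 2 ^ (k : ℕ) *
            (if (i : ℕ) < k ∧ b i then (2 : ℝ) ^ (i : ℕ) else 0) : ℝ) : ℂ) * Complex.I) := by
      intro i
      split_ifs
      · congr 3; ring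
      · simp
    simp only [this]
    rw [← Complex.exp_sum, ← Finset.sum_mul, ← Complex.ofReal_sum, ← Finset.mul_sum, lowBits]
    congr 3
    ring
  rw [h1, ← Complex.exp_add, ← Complex.exp_add, levelPhase, levelTime]
  congr 1
  push_cast
  field_simp
  ring

lemma simulable_hadamardTest {n c s p R : ℕ} (H : NormalizedHamiltonian n) {T α : ℝ} (hT : 0 < T)
    (h : SimulatedUpTo H T α c s)
    {m : ℕ} (k : Fin m) (r : Fin R) :
    Simulable H c (fun E => hadamardTest ((k, some (Sum.inl r)) : EstWires m R) fun y =>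
        levelPhase ((E + 2) * 2 ^ p) k (outBits y))
      (⌈levelTime p k / T⌉₊ * (s * 7) + m + 3) (⌈levelTime p k / T⌉₊ * queryError α) := by
  set a : EstWires m R := (k, some (Sum.inl r)) with ha
  have hH : Simulable H c (fun _ => hadamard a) 1 0 :=
    Simulable.of_hasCircuit (isGate_hadamard a).hasCircuit
  have hE := simulable_controlled_long_evolution H hT h a
    (show 0 < levelTime p k by have := Real.pi_pos; unfold levelTime; positivity)
  have hC : HasCircuit (Matrix.diagonal fun y : Bits (EstWires m R) => if y a then
      Complex.exp (((-(2 * levelTime p k) : ℝ) : ℂ) * Complex.I) else 1 : QOp (EstWires m R)) 1 :=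
    (isGate_diagonal (single a) (by simp) (d := fun v => if v () then
      Complex.exp (((-(2 * levelTime p k) : ℝ) : ℂ) * Complex.I) else 1) fun v => by
        split_ifs
        · exact Complex.norm_exp_ofReal_mul_I _
        · exact norm_one).hasCircuit
  have hF : HasCircuit ((List.finRange m).map fun i : Fin m =>
      (Matrix.diagonal fun y : Bits (EstWires m R) =>
      if y a then (if (i : ℕ) < k ∧ outBits y i then
        Complex.exp (((Real.pi * 2 ^ (i : ℕ) / 2 ^ (k : ℕ) : ℝ) : ℂ) * Complex.I) else 1) else 1 :
      QOp (EstWires m R))).prod m := by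
    refine (HasCircuit.list_prod (s := 1) _ ?_).mono (by simp)
    simp only [List.mem_map]
    rintro _ ⟨i, -, rfl⟩
    refine (isGate_diagonal (pair a (i, none) (by simp [ha])) (by simp) (d := fun v => if v 0 then
      (if (i : ℕ) < k ∧ v 1 then
        Complex.exp (((Real.pi * 2 ^ (i : ℕ) / 2 ^ (k : ℕ) : ℝ) : ℂ) * Complex.I) else 1) else 1)
          fun v => ?_).hasCircuit
    split_ifs
    · exact Complex.norm_exp_ofReal_mul_I _
    · exact norm_one
    · exact norm_one
  have key := (hH.mul (hE.mul (Simulable.of_hasCircuit (hC.mul hF)))).mul hH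
  refine (Simulable.mono (t := ⌈levelTime p k / T⌉₊ * (s * 7) + m + 3)
    (ε := ⌈levelTime p k / T⌉₊ * queryError α)
    ?_ le_rfl le_rfl)
  convert key using 1
  · ext1 E
    rw [hadamardTest, list_diagonal_prod, Matrix.diagonal_mul_diagonal,
      Matrix.diagonal_mul_diagonal]
    congr 3
    ext y
    split_ifs with hy
    · exact levelPhase_eq p E k _
    · simp
  · ring
  · ring

/-- The size of the circuit of a level: the majority of `R` tests, and for each test `N` controlled
evolutions, `m` phases controlled by the digits, and three more gates. -/
def levelSize (m R s N : ℕ) : ℕ := 8 * (R + 1) ^ 2 + R * (N * (s * 7) + m + 3)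

lemma simulable_levelOp {n c s p R : ℕ} (H : NormalizedHamiltonian n) {T α : ℝ} (hT : 0 < T)
    (h : SimulatedUpTo H T α c s)
    {M : QOp (LevelWires R)} (hM : HasCircuit M (8 * (R + 1) ^ 2)) {m : ℕ} (k : Fin m) :
    Simulable H c (fun E => levelOp M (levelPhase ((E + 2) * 2 ^ p) k) k)
      (levelSize m R s ⌈levelTime p k / T⌉₊) (R * (⌈levelTime p k / T⌉₊ * queryError α)) := by
  have h1 := (Simulable.of_hasCircuit (n := n) (H := H) (c := c) (hM.place (levelEmb k))).mul
    (Simulable.list_prod (List.finRange R) _ fun r _ => simulable_hadamardTest (p := p) H hT h k r)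
  refine h1.mono (le_of_eq ?_) (le_of_eq ?_)
  · simp [levelSize]
  · simp

lemma exists_simulable_estState {n c s p R : ℕ} (H : NormalizedHamiltonian n) {T α : ℝ} (hT : 0 < T)
    (h : SimulatedUpTo H T α c s)
    (m : ℕ) : ∃ (w : Bits (Fin R) → Bits (Fin (R + 1))) (A : ℝ → QOp (EstWires m R)),
      Simulable H c A (∑ k ∈ Finset.range m, levelSize m R s ⌈levelTime p k / T⌉₊)
        (∑ k ∈ Finset.range m, R * (⌈levelTime p k / T⌉₊ * queryError α)) ∧
      ∀ E, (A E).app (zeroKet _) = estState w (levelPhase ((E + 2) * 2 ^ p)) m := by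
  obtain ⟨M, w, hM, hMw⟩ := exists_majority_circuit R
  refine ⟨w, ?_⟩
  suffices ∀ k ≤ m, ∃ A : ℝ → QOp (EstWires m R),
      Simulable H c A (∑ k ∈ Finset.range k, levelSize m R s ⌈levelTime p k / T⌉₊)
        (∑ k ∈ Finset.range k, R * (⌈levelTime p k / T⌉₊ * queryError α)) ∧
      ∀ E, (A E).app (zeroKet _) = estState w (levelPhase ((E + 2) * 2 ^ p)) k from this m le_rfl
  intro k
  induction k with
  | zero => exact fun _ => ⟨fun _ => 1, by simpa using Simulable.one,
    fun E => by rw [one_app, estState_zero]⟩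
  | succ k ih =>
    intro hk
    obtain ⟨A, hA, hAE⟩ := ih (by omega)
    have hL := simulable_levelOp (p := p) H hT h hM (⟨k, hk⟩ : Fin m)
    refine ⟨_, (hL.mul hA).mono (le_of_eq ?_) (le_of_eq ?_), fun E => ?_⟩
    · rw [Finset.sum_range_succ, add_comm]
    · rw [Finset.sum_range_succ, add_comm]
    · rw [mul_app, hAE]
      exact levelOp_app_estState hMw (levelPhase_congr _) ⟨k, hk⟩

lemma NormalizedHamiltonian.abs_eigenvalue_le_one {n : ℕ} (H : NormalizedHamiltonian n) {E : ℝ}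
    {ψ : QState (Fin n)} (hψ1 : ‖ψ‖ = 1) (hψ : H.op.app ψ = (E : ℂ) • ψ) : |E| ≤ 1 := by
  have h := norm_app_le H.op ψ
  rw [hψ, norm_smul, H.norm_eq_one, hψ1] at h
  simpa using h

/-- The amplitude `a e` and the state `g e` of a pre-measurement are the norm and the direction of
the component of `Φ` with output `e`; if this component vanishes, any unit vector will do. -/
lemma isPremeasurement_of_state {n p w : ℕ} {H : NormalizedHamiltonian n} {η δ : ℝ}
    {U : QOp (Fin n ⊕ (Fin (p + 2) ⊕ Fin w))}
    (h : ∀ (E : ℝ) (ψ : QState (Fin n)), ‖ψ‖ = 1 → H.op.app ψ = (E : ℂ) • ψ →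
      ∃ Φ : QState (Fin (p + 2) ⊕ Fin w),
        U.app (tensorState ψ (tensorState (zeroKet (Fin (p + 2))) (zeroKet (Fin w)))) =
          tensorState ψ Φ ∧
        η ≤ ∑ z : Bits (Fin (p + 2) ⊕ Fin w) with |E - outcomeValue (z ∘ Sum.inl)| ≤ δ, ‖Φ z‖ ^ 2) :
    IsPremeasurement H η δ U := by
  intro E ψ hψ1 hψ
  obtain ⟨Φ, hΦ, hη⟩ := h E ψ hψ1 hψ
  let sl : Bits (Fin (p + 2)) → QState (Fin w) := fun e => WithLp.toLp 2 fun v => Φ (Sum.elim e v)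
  refine ⟨fun e => (‖sl e‖ : ℂ), fun e => if sl e = 0 then zeroKet _ else (‖sl e‖ : ℂ)⁻¹ • sl e,
    fun e => ?_, ?_, ?_⟩
  · dsimp only
    split_ifs with h0
    · simp [zeroKet, basisKet]
    · have : ‖sl e‖ ≠ 0 := norm_ne_zero_iff.mpr h0
      rw [norm_smul, norm_inv, Complex.norm_real, norm_norm, inv_mul_cancel₀ this]
  · rw [hΦ]
    congr 1
    ext z
    have hterm : ∀ e, ((‖sl e‖ : ℂ) • tensorState (basisKet e)
        (if sl e = 0 then zeroKet _ else (‖sl e‖ : ℂ)⁻¹ • sl e) : QState (Fin (p + 2) ⊕ Fin w)) z =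
        if z ∘ Sum.inl = e then Φ z else 0 := by
      intro e
      rw [PiLp.smul_apply, tensorState_apply, basisKet_apply]
      by_cases hz : z ∘ Sum.inl = e
      · have hsl : sl e (z ∘ Sum.inr) = Φ z := by
          change Φ (Sum.elim e (z ∘ Sum.inr)) = Φ z
          rw [← hz, Sum.elim_comp_inl_inr]
        rw [if_pos hz, if_pos hz, one_mul, smul_eq_mul]
        split_ifs with h0
        · rw [← hsl, h0]; simp
        · have : (‖sl e‖ : ℂ) ≠ 0 := by exact_mod_cast norm_ne_zero_iff.mpr h0
          rw [PiLp.smul_apply, smul_eq_mul, ← mul_assoc, mul_inv_cancel₀ this, one_mul, hsl]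
      · simp [hz]
    rw [WithLp.ofLp_sum, Finset.sum_apply]
    simp only [hterm]
    simp
  · refine hη.trans (le_of_eq ?_)
    have hn : ∀ e, ‖((‖sl e‖ : ℝ) : ℂ)‖ ^ 2 = ∑ v, ‖Φ (Sum.elim e v)‖ ^ 2 := fun e => by
      rw [Complex.norm_real, norm_norm, EuclideanSpace.norm_sq_eq]
    simp only [hn]
    rw [Finset.sum_filter, Finset.sum_filter, ← (Equiv.sumArrowEquivProdArrow (Fin (p + 2)) (Fin w)
      Bool).symm.sum_comp,
      Fintype.sum_prod_type]
    refine Finset.sum_congr rfl fun e _ => ?_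
    have : ∀ v : Bits (Fin w), ((Equiv.sumArrowEquivProdArrow (Fin (p + 2)) (Fin w) Bool).symm
      (e, v)) = Sum.elim e v := fun v => rfl
    simp only [this, Sum.elim_comp_inl]
    split_ifs <;> simp

end

/-! ### Registers of a pre-measurement -/

noncomputable section

variable {ι κ μ : Type} [Fintype ι] [DecidableEq ι] [Fintype κ] [DecidableEq κ] [Fintype μ]
  [DecidableEq μ]

/-- The state `φ` with its wires renamed along `e`. -/
def QState.rename (e : ι ≃ κ) (φ : QState ι) : QState κ := WithLp.toLp 2 fun x => φ (x ∘ e)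

lemma QState.rename_apply (e : ι ≃ κ) (φ : QState ι) (x : Bits κ) : φ.rename e x = φ (x ∘ e) := rfl

lemma place_app_rename (e : ι ≃ κ) (M : QOp ι) (φ : QState ι) :
    (place e.toEmbedding M).app (φ.rename e) = (M.app φ).rename e := by
  ext x
  rw [place_app_eq, QState.rename_apply]
  refine congrArg (fun χ => QOp.app M χ (x ∘ e)) ?_
  ext v
  exact congrArg φ (overwrite_comp e.toEmbedding x v)

lemma rename_sumCongr_tensorState (f : κ ≃ μ) (ψ : QState ι) (φ : QState κ) :
    (tensorState ψ φ).rename (Equiv.sumCongr (Equiv.refl ι) f) = tensorState ψ (φ.rename f) := rfl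

lemma zeroKet_rename (e : ι ≃ κ) : (zeroKet ι).rename e = zeroKet κ := by
  ext x
  rw [QState.rename_apply, zeroKet_apply, zeroKet_apply]
  congr 1
  refine propext ⟨fun h => funext fun k => ?_, fun h => by rw [h]; rfl⟩
  simpa using congrFun h (e.symm k)

lemma tensorState_zeroKet_zeroKet : tensorState (zeroKet ι) (zeroKet κ) = zeroKet (ι ⊕ κ) := by
  ext x
  rw [tensorState_apply, zeroKet_apply, zeroKet_apply, zeroKet_apply, mul_ite, mul_one,
    mul_zero, ← ite_and]
  congr 1
  refine propext ⟨fun ⟨h2, h1⟩ => funext ?_, fun h => by rw [h]; exact ⟨rfl, rfl⟩⟩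
  rintro (i | k)
  exacts [congrFun h1 i, congrFun h2 k]

/-- The majority bits become the output register; the ancillas and all other wires become the work
register. -/
lemma exists_equiv_output_work (c m R : ℕ) :
    ∃ f : Fin c ⊕ EstWires m R ≃ Fin m ⊕ Fin (c + m * (2 * R + 1)),
    ∀ k, f (Sum.inr (k, none)) = Sum.inl k := by
  have g : Fin c ⊕ (Fin m × (Fin R ⊕ Fin (R + 1))) ≃ Fin (c + m * (2 * R + 1)) :=
    Fintype.equivFinOfCardEq (by simp; left; ring)
  let f₀ : Fin c ⊕ EstWires m R ≃ Fin m ⊕ (Fin c ⊕ (Fin m × (Fin R ⊕ Fin (R + 1)))) :=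
    { toFun := fun
        | .inl a => .inr (.inl a)
        | .inr (k, none) => .inl k
        | .inr (k, some x) => .inr (.inr (k, x))
      invFun := fun
        | .inl k => .inr (k, none)
        | .inr (.inl a) => .inl a
        | .inr (.inr (k, x)) => .inr (k, some x)
      left_inv := by rintro (a | ⟨k, _ | x⟩) <;> rfl
      right_inv := by rintro (k | a | ⟨k, x⟩) <;> rfl }
  exact ⟨f₀.trans (Equiv.sumCongr (Equiv.refl _) g), fun k => rfl⟩

/-- A simulable operation that writes the energy on the majority bits gives a pre-measurement. -/
lemma Simulable.exists_premeasurement {n c s p R : ℕ} {H : NormalizedHamiltonian n} {δ η ε : ℝ}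
    {A : ℝ → QOp (EstWires (p + 2) R)} (hA : Simulable H c A s ε)
    (h : ∀ E : ℝ, |E| ≤ 1 → η ≤ ∑ y : Bits (EstWires (p + 2) R) with
        |E - outcomeValue (outBits y)| ≤ δ,
      ‖(A E).app (zeroKet _) y‖ ^ 2) :
    ∃ U V : QOp (Fin n ⊕ (Fin (p + 2) ⊕ Fin (c + (p + 2) * (2 * R + 1)))),
      U ∈ Matrix.unitaryGroup _ ℂ ∧ V ∈ Matrix.unitaryGroup _ ℂ ∧ IsPremeasurement H η δ U ∧
        HasCircuit V s ∧ ‖U - V‖ ≤ ε := by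
  obtain ⟨U, V, hU, hV, hUV, hUA⟩ := hA
  obtain ⟨f, hf⟩ := exists_equiv_output_work c (p + 2) R
  set e := Equiv.sumCongr (Equiv.refl (Fin n)) f
  refine ⟨place e.toEmbedding U, place e.toEmbedding V, place_mem_unitary _ hU,
    place_mem_unitary _ hV.mem_unitary, isPremeasurement_of_state fun E ψ hψ1 hψ => ?_, hV.place _,
    (norm_place_sub_le _ _ _).trans hUV⟩
  refine ⟨(tensorState (zeroKet (Fin c)) ((A E).app (zeroKet _))).rename f, ?_, ?_⟩
  · rw [tensorState_zeroKet_zeroKet, ← zeroKet_rename f, ← tensorState_zeroKet_zeroKet,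
      ← rename_sumCongr_tensorState, place_app_rename, hUA E ψ hψ, rename_sumCongr_tensorState]
  refine (h E (H.abs_eigenvalue_le_one hψ1 hψ)).trans ?_
  -- the values of the ancilla register other than `0` contribute nonnegative terms
  let F : Bits (EstWires (p + 2) R) → Bits (Fin (p + 2) ⊕ Fin (c + (p + 2) * (2 * R + 1))) :=
    fun y => Sum.elim (fun _ => false) y ∘ f.symm
  have hF : ∀ y, F y ∘ f = Sum.elim (fun _ => false) y := fun y => by
    ext i; simp [F]
  have hFinj : Function.Injective F := fun y z hyz => by
    have := congrArg (· ∘ f) hyz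
    simp only [hF] at this
    exact funext fun i => congrFun this (Sum.inr i)
  have hout : ∀ y, F y ∘ Sum.inl = outBits y := fun y => by
    ext k
    rw [Function.comp_apply, ← hf k]
    exact congrFun (hF y) (Sum.inr (k, none))
  calc _ = ∑ y : Bits (EstWires (p + 2) R) with |E - outcomeValue (outBits y)| ≤ δ,
      ‖(tensorState (zeroKet (Fin c)) ((A E).app (zeroKet _))).rename f (F y)‖ ^ 2 := by
        refine Finset.sum_congr rfl fun y _ => ?_
        rw [QState.rename_apply, hF, tensorState_apply]
        simp [zeroKet_apply]
    _ = ∑ z ∈ (Finset.univ.filter fun y : Bits (EstWires (p + 2) R) =>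
          |E - outcomeValue (outBits y)| ≤ δ).map ⟨F, hFinj⟩,
        ‖(tensorState (zeroKet (Fin c)) ((A E).app (zeroKet _))).rename f z‖ ^ 2 := by
        rw [Finset.sum_map]; rfl
    _ ≤ _ := by
        refine Finset.sum_le_sum_of_subset_of_nonneg ?_ fun _ _ _ => sq_nonneg _
        intro z hz
        obtain ⟨y, hy, rfl⟩ := Finset.mem_map.mp hz
        rw [Finset.mem_filter] at hy ⊢
        refine ⟨Finset.mem_univ _, ?_⟩
        change |E - outcomeValue (F y ∘ Sum.inl)| ≤ δ
        rw [hout]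
        exact hy.2

/-- Phase estimation with `p + 2` digits and `3 n` tests for each. The number of tests is such that
the failure probability `(9 / 10) ^ n` is at most `e^{-n/18}`. -/
lemma exists_phase_estimation {n c s p : ℕ} (hn : 1 ≤ n) (H : NormalizedHamiltonian n)
    {T α δ : ℝ} (hT : 0 < T)
    (h : SimulatedUpTo H T α c s)
    (hδ : 2 / 3 / 2 ^ p ≤ δ) :
    ∃ U V : QOp (Fin n ⊕ (Fin (p + 2) ⊕ Fin (c + (p + 2) * (2 * (3 * n) + 1)))),
      U ∈ Matrix.unitaryGroup _ ℂ ∧ V ∈ Matrix.unitaryGroup _ ℂ ∧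
        IsPremeasurement H (1 - Real.exp (-(n : ℝ) / 18)) δ U ∧
        HasCircuit V (∑ k ∈ Finset.range (p + 2),
          levelSize (p + 2) (3 * n) s ⌈levelTime p k / T⌉₊) ∧
        ‖U - V‖ ≤ ∑ k ∈ Finset.range (p + 2),
            (3 * n : ℕ) * (⌈levelTime p k / T⌉₊ * queryError α) := by
  obtain ⟨w, A, hA, hAE⟩ := exists_simulable_estState (p := p) (R := 3 * n) H hT h (p + 2)
  refine hA.exists_premeasurement fun E hE =>
    (one_sub_exp_le_sum_outcomeProb hn p hE hδ).trans (le_of_eq ?_)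
  rw [Finset.sum_filter, Finset.sum_filter, ← Finset.sum_fiberwise Finset.univ outBits]
  refine Finset.sum_congr rfl fun b _ => ?_
  rw [outcomeProb, ← sum_estState_norm_sq w]
  split_ifs with hb
  · refine Finset.sum_congr rfl fun y hy => ?_
    rw [(Finset.mem_filter.mp hy).2, if_pos hb, hAE]
  · refine (Finset.sum_eq_zero fun y hy => ?_).symm
    rw [(Finset.mem_filter.mp hy).2, if_neg hb]

end

/-! ### Resources and parameters -/

noncomputable section

/-- A bound by `2 ^ r(n)` up to a constant and for large `n` only holds exactly and for all `n`
with another polynomial. -/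
lemma exists_le_two_pow_of_isBigO {T : ℕ → ℝ} {r : Polynomial ℕ}
    (h : T =O[Filter.atTop] fun n : ℕ => (2 : ℝ) ^ (r.eval n)) :
    ∃ Q : Polynomial ℕ, ∀ n, T n ≤ 2 ^ (Q.eval n) := by
  obtain ⟨C, hC⟩ := h.bound
  obtain ⟨N, hN⟩ := Filter.eventually_atTop.mp hC
  obtain ⟨B, hB⟩ := pow_unbounded_of_one_lt (|C| + ∑ i ∈ Finset.range N, |T i|)
    (one_lt_two (α := ℝ))
  refine ⟨r + Polynomial.C B, fun n => ?_⟩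
  rw [Polynomial.eval_add, Polynomial.eval_C, pow_add, mul_comm]
  have h1 : (1 : ℝ) ≤ 2 ^ r.eval n := one_le_pow₀ one_le_two
  have hS : 0 ≤ ∑ i ∈ Finset.range N, |T i| := Finset.sum_nonneg fun _ _ => abs_nonneg _
  rcases lt_or_ge n N with hn | hn
  · have h2 : |T n| ≤ ∑ i ∈ Finset.range N, |T i| :=
      Finset.single_le_sum (f := fun i => |T i|) (fun _ _ => abs_nonneg _) (Finset.mem_range.mpr hn)
    have h3 := le_abs_self (T n)
    have h4 : T n ≤ 2 ^ B := by linarith [abs_nonneg C]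
    nlinarith [show (0 : ℝ) < 2 ^ B by positivity]
  · have h2 := hN n hn
    rw [Real.norm_eq_abs, Real.norm_of_nonneg (by positivity)] at h2
    have h3 : C ≤ 2 ^ B := by linarith [le_abs_self C]
    nlinarith [le_abs_self (T n)]

/-- The number of simulated evolutions in one test at each level. It is at most
`2 π 2 ^ p / T + p + 2`, as the times of the levels form a geometric series and each is rounded
up. -/
lemma sum_queries_le {p : ℕ} {T : ℝ} (hT : 0 < T) (hp : (2 : ℝ) ^ p ≤ 4 / 3 * T) :
    ∑ k ∈ Finset.range (p + 2), (⌈levelTime p k / T⌉₊ : ℝ) ≤ p + 10.38 := by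
  have hpi := Real.pi_pos
  have h1 : ∀ k ∈ Finset.range (p + 2), (⌈levelTime p k / T⌉₊ : ℝ) ≤
      Real.pi * (2 ^ p / T) * (1 / 2) ^ k + 1 := by
    intro k _
    have h0 : 0 ≤ levelTime p k / T := by unfold levelTime; positivity
    refine (Nat.ceil_lt_add_one h0).le.trans (le_of_eq ?_)
    rw [levelTime, one_div, inv_pow]
    ring
  refine (Finset.sum_le_sum h1).trans ?_
  rw [Finset.sum_add_distrib, ← Finset.mul_sum]
  have h2 : ∑ k ∈ Finset.range (p + 2), (1 / 2 : ℝ) ^ k ≤ 2 := sum_geometric_two_le _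
  have h3 : (2 : ℝ) ^ p / T ≤ 4 / 3 := by rw [div_le_iff₀ hT]; exact hp
  have h4 : Real.pi * (2 ^ p / T) ≤ 3.1416 * (4 / 3) :=
    mul_le_mul Real.pi_lt_d4.le h3 (by positivity) (by norm_num)
  have h5 : Real.pi * (2 ^ p / T) * ∑ k ∈ Finset.range (p + 2), (1 / 2 : ℝ) ^ k ≤
      3.1416 * (4 / 3) * 2 :=
    mul_le_mul h4 h2 (Finset.sum_nonneg fun _ _ => by positivity) (by norm_num)
  simp only [Finset.sum_const, Finset.card_range, nsmul_eq_mul, mul_one]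
  push_cast
  linarith

/-- For a short time the constant `0` is an accurate enough estimate of the energy. -/
lemma exists_trivial_premeasurement {n : ℕ} (H : NormalizedHamiltonian n) {η δ : ℝ} (hη : η ≤ 1)
    (hδ : 1 ≤ δ) : ∃ U : QOp (Fin n ⊕ (Fin (0 + 2) ⊕ Fin 0)), IsPremeasurement H η δ U ∧
        HasCircuit U 1 := by
  refine ⟨place Function.Embedding.inr (permOp (negate (Sum.inl 1))),
    isPremeasurement_of_state fun E ψ hψ1 hψ => ?_,
    ((isGate_negate _).place _).hasCircuit⟩
  refine ⟨(permOp (negate (Sum.inl 1))).app (tensorState (zeroKet _) (zeroKet _)),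
    place_inr_app_tensorState _ _ _, ?_⟩
  set z : Bits (Fin (0 + 2) ⊕ Fin 0) := negate (Sum.inl 1) fun _ => false with hz
  have hz0 : outcomeValue (p := 0) (z ∘ Sum.inl) = 0 := by
    simp [outcomeValue, hz, negate_apply, Fin.sum_univ_two]
  refine hη.trans (le_trans (le_of_eq ?_) (Finset.single_le_sum (fun _ _ => sq_nonneg _)
    (Finset.mem_filter.mpr ⟨Finset.mem_univ z, ?_⟩)))
  · rw [tensorState_zeroKet_zeroKet, permOp_app, hz, Equiv.symm_apply_apply, zeroKet_apply]
    simp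
  · rw [hz0, sub_zero]
    exact (H.abs_eigenvalue_le_one hψ1 hψ).trans hδ

/-- The errors of `3 n` tests at each level, `S` being the number of simulated evolutions in one
round. The constant `16` suffices since `27 / 4 (L + 6.38) ≤ 16 L` for `L ≥ 5`. -/
lemma error_le {n p : ℕ} {α L : ℝ} (hα : 0 ≤ α) (hα8 : α ≤ 1 / 8) (hL : 5 ≤ L) (hp : p + 4 ≤ L)
    {S : ℝ} (hS : S ≤ p + 10.38) : (3 * n : ℕ) * (S * queryError α) ≤ 16 * n * α * L := by
  rw [queryError, if_pos hα8]
  have h1 : 27 / 4 * S ≤ 16 * L := by linarith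
  have h2 := mul_le_mul_of_nonneg_left h1 (show 0 ≤ n * α by positivity)
  push_cast
  linarith

lemma sum_levelSize_le {p Q R s : ℕ} {N : ℕ → ℕ} (hp : p ≤ Q + 1)
    (hN : ∑ k ∈ Finset.range (p + 2), N k ≤ p + 11) :
    ∑ k ∈ Finset.range (p + 2), levelSize (p + 2) R s (N k) ≤
      (Q + 3) * (8 * (R + 1) ^ 2) + R * ((Q + 12) * (s * 7) + (Q + 3) * (Q + 6)) := by
  have h : ∑ k ∈ Finset.range (p + 2), levelSize (p + 2) R s (N k) =
      (p + 2) * (8 * (R + 1) ^ 2) + R * ((∑ k ∈ Finset.range (p + 2), N k) * (s * 7) +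
          (p + 2) * (p + 5)) := by
    simp only [levelSize, Finset.sum_add_distrib, ← Finset.mul_sum, Finset.sum_const,
      Finset.card_range,
      smul_eq_mul, ← Finset.sum_mul]
    ring
  have h1 : p + 2 ≤ Q + 3 := by omega
  have h2 : p + 5 ≤ Q + 6 := by omega
  have h3 : ∑ k ∈ Finset.range (p + 2), N k ≤ Q + 12 := by omega
  rw [h]
  exact add_le_add (Nat.mul_le_mul_right _ h1)
    (Nat.mul_le_mul_left _ (add_le_add (Nat.mul_le_mul_right _ h3) (Nat.mul_le_mul h1 h2)))

theorem claim4p1 (H : ∀ n : ℕ, NormalizedHamiltonian n) (T α : ℕ → ℝ)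
    (hT : ∀ n : ℕ, 1 ≤ n → 1 / 32 ≤ T n)
    (hTO : ∃ q : Polynomial ℕ,
      T =O[Filter.atTop] fun n : ℕ => (2 : ℝ) ^ (q.eval n))
    (hFF : IsFF H T α) :
    IsSEEM H (fun n => 1 - Real.exp (-(n : ℝ) / 18)) (fun n => 1 / T n)
      (fun n => 16 * (n : ℝ) * α n * Real.logb 2 (32 * T n)) := by
  obtain ⟨r, hr⟩ := hTO
  obtain ⟨Q, hQ⟩ := exists_le_two_pow_of_isBigO hr
  obtain ⟨q, hq⟩ := hFF
  -- the bound for the size of the circuit, with `p ≤ Q n + 1`, plus one for the number of qubits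
  refine ⟨(Q + 3) * (8 * (3 * Polynomial.X + 1) ^ 2) +
    3 * Polynomial.X * ((Q + 12) * (q * 7) + (Q + 3) * (Q + 6)) +
    (Q + 3 + (q + (Q + 3) * (2 * (3 * Polynomial.X) + 1))), fun n hn => ?_⟩
  simp only [Polynomial.eval_add, Polynomial.eval_mul, Polynomial.eval_pow, Polynomial.eval_X,
    Polynomial.eval_ofNat, Polynomial.eval_one]
  have hT0 : 0 < T n := lt_of_lt_of_le (by norm_num) (hT n hn)
  -- the simulation of the evolution for the time `0` shows that `α n` is not negative
  have hα : 0 ≤ α n := by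
    obtain ⟨c, -, V, -, hV⟩ := hq n hn 0 le_rfl hT0.le
    exact (norm_nonneg _).trans (hV (zeroKet _) (by simp [zeroKet, basisKet]))
  rcases le_or_gt (T n) 1 with hT1 | hT1
  · obtain ⟨U, hU, hUc⟩ := exists_trivial_premeasurement (H n) (η := 1 - Real.exp (-(n : ℝ) / 18))
      (δ := 1 / T n) (by linarith [Real.exp_pos (-(n : ℝ) / 18)])
        (by rw [le_div_iff₀ hT0]; linarith)
    refine ⟨0, 0, le_trans (by omega) (Nat.le_add_left _ _), U, U, hUc.mem_unitary,
      hUc.mem_unitary, hU,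
      hUc.mono (le_trans (by omega) (Nat.le_add_left _ _)), ?_⟩
    have hL : 0 ≤ Real.logb 2 (32 * T n) := Real.logb_nonneg one_lt_two (by linarith [hT n hn])
    rw [sub_self, norm_zero]
    positivity
  · obtain ⟨p, hp, hp'⟩ := exists_nat_pow_near (show 1 ≤ 4 / 3 * T n by linarith) one_lt_two
    -- `2 ^ p ≤ 4 / 3 * 2 ^ Q n < 2 ^ (Q n + 1)`
    have hpQ : p ≤ Q.eval n + 1 := by
      have : (2 : ℝ) ^ p ≤ 2 ^ (Q.eval n + 1) := by
        rw [pow_succ]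
        linarith [hQ n]
      exact (pow_le_pow_iff_right₀ one_lt_two).mp this
    have hδ : (2 / 3 : ℝ) / 2 ^ p ≤ 1 / T n := by
      rw [div_le_div_iff₀ (by positivity) hT0]
      rw [pow_succ] at hp'
      linarith
    obtain ⟨U, V, hU, hV, hUm, hVc, hUV⟩ := exists_phase_estimation hn (H n) hT0 (hq n hn) hδ
    have hS := sum_queries_le hT0 hp
    have hSN : ∑ k ∈ Finset.range (p + 2), ⌈levelTime p k / T n⌉₊ ≤ p + 11 := by
      have : ((∑ k ∈ Finset.range (p + 2), ⌈levelTime p k / T n⌉₊ : ℕ) : ℝ) ≤ (p + 11 : ℕ) := by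
        push_cast
        linarith
      exact_mod_cast this
    have hL5 : 5 ≤ Real.logb 2 (32 * T n) := by
      rw [Real.le_logb_iff_rpow_le one_lt_two (by linarith)]
      norm_num
      linarith
    -- `2 ^ (p + 4) ≤ 64 / 3 * T n`
    have hLp : (p : ℝ) + 4 ≤ Real.logb 2 (32 * T n) := by
      rw [Real.le_logb_iff_rpow_le one_lt_two (by linarith), Real.rpow_add two_pos,
        Real.rpow_natCast]
      norm_num
      linarith
    have hw : (p + 2) * (2 * (3 * n) + 1) ≤ (Q.eval n + 3) * (2 * (3 * n) + 1) :=
      Nat.mul_le_mul_right _ (by omega)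
    refine ⟨p, _, ?_, U, V, hU, hV, hUm, hVc.mono ?_, ?_⟩
    · refine le_trans ?_ (Nat.le_add_left _ _)
      omega
    · refine le_trans ?_ (Nat.le_add_right _ _)
      exact sum_levelSize_le hpQ hSN
    · rcases le_or_gt (α n) (1 / 8) with hα8 | hα8
      · rw [← Finset.mul_sum, ← Finset.sum_mul] at hUV
        exact hUV.trans (error_le hα hα8 hL5 hLp hS)
      -- here the bound is at least `16 * (1 / 8) * 5`
      · refine (norm_sub_le_two hU hV).trans ?_
        have hn1 : (1 : ℝ) ≤ n := by exact_mod_cast hn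
        have h1 : 1 / 8 ≤ n * α n := by nlinarith
        nlinarith

end
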